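/- Let $K$ be a field, $\theta$ an automorphism of $K$ of finite order $r$, $F=K^{\theta}$ its fixed field, and $F^{\mathrm s}$ a separable closure of $F$. Let $\mathcal A=K[X^{\pm1};\theta]$ be the ring of skew Laurent polynomials ($Xa=\theta(a)X$ for $a\in K$), $Y=X^r$, and $\mathrm{Frac}(\mathcal A)=F(Y)\otimes_{F[Y]}\mathcal A$ its skew field of fractions. For $z\in F^{\mathrm s}$, $z\ne0$, with minimal polynomial $N\in F[Y]$ over $F$, put $\hat{\mathcal A}_N=\varprojlim_m \mathcal A/N^m\mathcal A$. A morphism of $K$-algebras $\tau_z:\hat{\mathcal A}_N\to(\mathcal A/N\mathcal A)[[T]]$ is called $z$-admissible if $\tau_z(X)\equiv X\pmod T$ and $\tau_z(Y)=z+T$, where $z$ is identified with the class of $Y$ in $\mathcal A/N\mathcal A$. It extends to $\mathrm{TS}_z:\mathrm{Frac}(\mathcal A)\to(\mathcal A/N\mathcal A)(\!(T)\!)$, and $\mathrm{sres}_z(f)\in\mathcal A/N\mathcal A$ is the coefficient of $T^{-1}$ in $\mathrm{TS}_z(f)$; it depends on $\tau_z$. The function $f$ has a simple pole at $z$ if $\mathrm{TS}_z(f)$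 has $T$-adic valuation $-1$ (this does not depend on $\tau_z$). We say that $f$ has no pole at $z$ if $f=D^{-1}g$ with $g\in\mathcal A$, $D\in F[Y]$, $D(z)\ne0$; its value at $z$ is then the element $D^{-1}g$ of $\mathcal A/N\mathcal A$. Let $\gamma:\mathrm{Frac}(\mathcal A)\to\mathrm{Frac}(\mathcal A)$ be an endomorphism of $K$-algebras; then $\gamma(Y)\in F(Y)$. Let $z\in F^{\mathrm s}$, $z\neq 0$, be a $\gamma$-regular point, i.e. $\gamma(Y)$ has no zero and no pole at $Y=z$, and let $\gamma_\star z$ be the value of $\gamma(Y)$ at $Y=z$. Assume moreover that $\gamma(X)$ has no pole at $z$ and that $\frac{d\gamma(Y)}{dY}$ does not vanish at $Y=z$. Let $N_1$ and $N_2$ be the minimal polynomials of $\gamma_\star z$ and $z$ over $F$. Then $\gamma$ induces a ring homomorphism $\bar\gamma:\mathcal A/N_1\mathcal A\to\mathcal A/N_2\mathcal A$ (the class of $a\in\mathcal A$ is sent to the value of $\gamma(a)$ at $z$), and: (i) for every $\gamma_\star z$-admissible $\tau_{\gamma_\star z}$ there exists a $z$-admissible $\tau_z$ such that $$\bar\gamma\big(\mathrm{sres}_{\gamma_\star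 z}(f)\big)=\mathrm{sres}_z\Big(\gamma(f)\,\frac{d\gamma(Y)}{dY}\Big)\qquad(\ast)$$ for all $f\in\mathrm{Frac}(\mathcal A)$; (ii) for every $f\in\mathrm{Frac}(\mathcal A)$, $f$ has a simple pole at $\gamma_\star z$ if and only if $\gamma(f)$ has a simple pole at $z$; when this occurs, $(\ast)$ holds for all admissible choices of $\tau_{\gamma_\star z}$ and $\tau_z$. -/

import Mathlib

open Polynomial
open scoped TensorProduct

noncomputable section

namespace SkewRes

universe u v

variable {K : Type u} [Field K]

/-! ### Skew Laurent polynomials -/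

/-- The action of `ℤ` on `K` through the powers of `θ`. -/
@[reducible]
def zpowAction (θ : RingAut K) : MulSemiringAction (Multiplicative ℤ) K :=
  MulSemiringAction.compHom K (zpowersHom (RingAut K) θ)

/-- The ring `𝒜 = K[X^{±1}; θ]` of skew Laurent polynomials `∑ aᵢ Xⁱ` (`i ∈ ℤ`, `aᵢ ∈ K`), with
multiplication `aXⁱ · bXʲ = a θⁱ(b) Xⁱ⁺ʲ`. -/
def SkewLaurent (_θ : RingAut K) : Type u := SkewMonoidAlgebra K (Multiplicative ℤ)

instance (θ : RingAut K) : Ring (SkewLaurent θ) :=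
  letI := zpowAction θ
  inferInstanceAs (Ring (SkewMonoidAlgebra K (Multiplicative ℤ)))

namespace SkewLaurent

variable (θ : RingAut K)

/-- The monomial `a Xⁱ`. -/
def monomial (i : ℤ) (a : K) : SkewLaurent θ :=
  SkewMonoidAlgebra.single (Multiplicative.ofAdd i) a

theorem monomial_mul_monomial (i j : ℤ) (a b : K) :
    monomial θ i a * monomial θ j b = monomial θ (i + j) (a * (θ ^ i) b) := by
  let := zpowAction θ
  exact SkewMonoidAlgebra.single_mul_single

theorem one_eq_monomial : (1 : SkewLaurent θ) = monomial θ 0 1 := rfl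

/-- The structural morphism `K → K[X^{±1}; θ]`. -/
def const : K →+* SkewLaurent θ where
  toFun a := monomial θ 0 a
  map_one' := rfl
  map_mul' a b := by rw [monomial_mul_monomial]; simp
  map_zero' := SkewMonoidAlgebra.single_zero _
  map_add' a b := SkewMonoidAlgebra.single_add _ a b

/-- The variable `X`. -/
def X : SkewLaurent θ := monomial θ 1 1

/-- The central element `Y = Xʳ`, where `r` is the order of `θ`. -/
def Y : SkewLaurent θ := X θ ^ orderOf θ

theorem X_pow (n : ℕ) : X θ ^ n = monomial θ n 1 := by
  induction n with
  | zero => simp [one_eq_monomial]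
  | succ n ih => rw [pow_succ, ih, X, monomial_mul_monomial]; simp

theorem Y_commute (f : SkewLaurent θ) : Commute f (Y θ) := by
  have hmon : ∀ (i : ℤ) (a : K), Commute (monomial θ i a) (Y θ) := fun i a => by
    rw [Y, X_pow, Commute, SemiconjBy, monomial_mul_monomial, monomial_mul_monomial,
      zpow_natCast, pow_orderOf_eq_one, add_comm]
    simp
  exact SkewMonoidAlgebra.induction_on (p := fun g => Commute (show SkewLaurent θ from g) (Y θ)) f
    (Commute.zero_left _) (fun g a => hmon g.toAdd a) (fun _ _ h₁ h₂ => Commute.add_left h₁ h₂)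

end SkewLaurent

/-- The subfield `F` of `K` fixed by `θ`. -/
abbrev FixedField (θ : RingAut K) : Subfield K :=
  RingHom.eqLocusField (θ : K →+* K) (RingHom.id K)

namespace SkewLaurent

variable (θ : RingAut K)

/-- The inclusion `𝒵⁺ = F[Y] → 𝒜` (the variable of the commutative polynomial ring `F[X]` of
Mathlib plays the role of `Y`). -/
def central : (FixedField θ)[X] →+* SkewLaurent θ :=
  Polynomial.eval₂RingHom' ((const θ).comp (FixedField θ).subtype) (Y θ) fun _ => Y_commute θ _

theorem const_commute (c : FixedField θ) (f : SkewLaurent θ) : Commute (const θ (c : K)) f := by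
  have hc : ∀ i : ℤ, (θ ^ i) (c : K) = c := by
    have h : θ ∈ MulAction.stabilizer (RingAut K) (c : K) := c.2
    intro i
    exact (MulAction.stabilizer (RingAut K) (c : K)).zpow_mem h i
  have hmon : ∀ (i : ℤ) (a : K), Commute (const θ (c : K)) (monomial θ i a) := fun i a => by
    change monomial θ 0 (c : K) * monomial θ i a = monomial θ i a * monomial θ 0 (c : K)
    rw [monomial_mul_monomial, monomial_mul_monomial, hc i, add_comm, mul_comm a]
    simp
  exact SkewMonoidAlgebra.induction_on
    (p := fun g => Commute (const θ (c : K)) (show SkewLaurent θ from g)) f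
    (Commute.zero_right _) (fun g a => hmon g.toAdd a) (fun _ _ h₁ h₂ => Commute.add_right h₁ h₂)

theorem central_commute (P : (FixedField θ)[X]) (f : SkewLaurent θ) :
    central θ P * f = f * central θ P := by
  induction P using Polynomial.induction_on' with
  | add p q hp hq => rw [map_add, add_mul, mul_add, hp, hq]
  | monomial n c =>
    have h : central θ (Polynomial.monomial n c) = const θ (c : K) * Y θ ^ n := by
      simp [central, Polynomial.eval₂RingHom']
    rw [h]
    exact Commute.mul_left (const_commute θ c f) ((Y_commute θ f).symm.pow_left n)

instance : Algebra (FixedField θ)[X] (SkewLaurent θ) :=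
  (central θ).toAlgebra' (central_commute θ)

end SkewLaurent

/-! ### The skew fraction field -/

/-- The fraction field `Frac(𝒜) = Frac(𝒵) ⊗ 𝒜` of `𝒜`, where `𝒵⁺ = F[Y]` is the base ring of the
tensor product and `Frac(𝒵) = Frac(𝒵⁺) = F(Y)`. -/
abbrev SkewFrac (θ : RingAut K) : Type u :=
  RatFunc (FixedField θ) ⊗[(FixedField θ)[X]] SkewLaurent θ

/-- The inclusion `𝒜 → Frac(𝒜)`. -/
def ofLaurent (θ : RingAut K) : SkewLaurent θ →+* SkewFrac θ :=
  (Algebra.TensorProduct.includeRight :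
    SkewLaurent θ →ₐ[(FixedField θ)[X]] SkewFrac θ).toRingHom

/-- The inclusion `F(Y) = Frac(𝒵) → Frac(𝒜)`. -/
def ofCentral (θ : RingAut K) : RatFunc (FixedField θ) →+* SkewFrac θ :=
  Algebra.TensorProduct.includeLeftRingHom

/-! ### Quotients and completions of `𝒜` -/

/-- The two-sided ideal `P𝒜 = 𝒜P`, for `P ∈ F[Y]`. -/
def centralIdeal (θ : RingAut K) (P : (FixedField θ)[X]) : Ideal (SkewLaurent θ) :=
  Ideal.span {algebraMap _ (SkewLaurent θ) P}

instance (θ : RingAut K) (P : (FixedField θ)[X]) : (centralIdeal θ P).IsTwoSided :=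
  ⟨fun {a} b ha => by
    obtain ⟨c, rfl⟩ := Ideal.mem_span_singleton'.1 ha
    exact Ideal.mem_span_singleton'.2 ⟨c * b, by
      rw [mul_assoc, mul_assoc, Algebra.commutes]⟩⟩

theorem centralIdeal_le_of_dvd (θ : RingAut K) {P Q : (FixedField θ)[X]} (h : P ∣ Q) :
    centralIdeal θ Q ≤ centralIdeal θ P := by
  obtain ⟨R, rfl⟩ := h
  refine Ideal.span_le.2 (Set.singleton_subset_iff.2 (Ideal.mem_span_singleton'.2 ?_))
  exact ⟨algebraMap _ _ R, by rw [← map_mul, mul_comm]⟩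

/-- The quotient ring `𝒜/P𝒜`. -/
abbrev Quot (θ : RingAut K) (P : (FixedField θ)[X]) : Type u := SkewLaurent θ ⧸ centralIdeal θ P

/-- The projection `𝒜 → 𝒜/P𝒜`. -/
abbrev toQuot (θ : RingAut K) (P : (FixedField θ)[X]) : SkewLaurent θ →+* Quot θ P :=
  Ideal.Quotient.mk (centralIdeal θ P)

/-- The completion `𝒜̂_N = lim 𝒜/Nᵐ𝒜`. -/
def Completion (θ : RingAut K) (N : (FixedField θ)[X]) : Subring (∀ m : ℕ, Quot θ (N ^ m)) where
  carrier := {x | ∀ (m n : ℕ) (h : m ≤ n),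
    Ideal.Quotient.factor (centralIdeal_le_of_dvd θ (pow_dvd_pow N h)) (x n) = x m}
  mul_mem' ha hb m n h := by rw [Pi.mul_apply, map_mul, ha m n h, hb m n h, Pi.mul_apply]
  one_mem' m n h := by simp
  add_mem' ha hb m n h := by rw [Pi.add_apply, map_add, ha m n h, hb m n h, Pi.add_apply]
  zero_mem' m n h := by simp
  neg_mem' ha m n h := by rw [Pi.neg_apply, map_neg, ha m n h, Pi.neg_apply]

/-- The canonical map `𝒜 → 𝒜̂_N`. -/
def toCompletion (θ : RingAut K) (N : (FixedField θ)[X]) : SkewLaurent θ →+* Completion θ N :=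
  (RingHom.pi fun m => toQuot θ (N ^ m)).codRestrict (Completion θ N) fun _ _ _ _ => rfl

/-! ### Taylor expansions -/

variable (θ : RingAut K) {Fs : Type v} [Field Fs] [Algebra (FixedField θ) Fs]

/-- A `z`-admissible morphism `τ : 𝒜̂_N → (𝒜/N𝒜)[[T]]`, where `N` is the minimal polynomial of `z`
over `F`: a morphism of `K`-algebras with `τ(X) ≡ X (mod T)` and `τ(Y) = z + T`, where `z` is viewed
in `𝒜/N𝒜` through the embedding `F(z) ≃ F[Y]/N → 𝒜/N𝒜`, that is, as the class of `Y`. -/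
structure Admissible (z : Fs) where
  toRingHom : Completion θ (minpoly (FixedField θ) z) →+*
    PowerSeries (Quot θ (minpoly (FixedField θ) z))
  map_const : ∀ a : K, toRingHom (toCompletion θ _ (SkewLaurent.const θ a)) =
    PowerSeries.C (toQuot θ _ (SkewLaurent.const θ a))
  map_X : PowerSeries.constantCoeff (toRingHom (toCompletion θ _ (SkewLaurent.X θ))) =
    toQuot θ _ (SkewLaurent.X θ)
  map_Y : toRingHom (toCompletion θ _ (SkewLaurent.Y θ)) =
    PowerSeries.C (toQuot θ _ (SkewLaurent.Y θ)) + PowerSeries.X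

namespace Admissible

variable {θ} {z : Fs} (τ : Admissible θ z)

/-- The restriction of `τ` to `𝒜`, with values in `(𝒜/N𝒜)((T))`. -/
def onLaurent : SkewLaurent θ →+* LaurentSeries (Quot θ (minpoly (FixedField θ) z)) :=
  (HahnSeries.ofPowerSeries ℤ _).comp (τ.toRingHom.comp (toCompletion θ _))

theorem isUnit_onLaurent [IsSepClosure (FixedField θ) Fs] {P : (FixedField θ)[X]}
    (hP : P ≠ 0) : IsUnit (τ.onLaurent (algebraMap _ _ P)) := by
  set N := minpoly (FixedField θ) z with hN
  have : Algebra.IsSeparable (FixedField θ) Fs := IsSepClosure.separable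
  have : Fact (Irreducible N) := ⟨minpoly.irreducible (Algebra.IsIntegral.isIntegral z)⟩
  let e : AdjoinRoot N →+* Quot θ N := Ideal.Quotient.lift (Ideal.span {N})
    ((toQuot θ N).comp (algebraMap _ _)) (fun a ha => by
      obtain ⟨b, rfl⟩ := Ideal.mem_span_singleton'.1 ha
      refine Ideal.Quotient.eq_zero_iff_mem.2 ?_
      rw [map_mul]
      exact Ideal.mul_mem_left _ _ (Ideal.subset_span rfl))
  have he : ∀ Q : (FixedField θ)[X], e (AdjoinRoot.mk N Q) = toQuot θ N (algebraMap _ _ Q) :=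
    fun Q => rfl
  let Q : (AdjoinRoot N)[X] := Polynomial.taylor (AdjoinRoot.root N) (P.map (AdjoinRoot.of N))
  have hQ : Q ≠ 0 := by
    intro h
    have h' : P.map (AdjoinRoot.of N) = 0 :=
      Polynomial.taylor_injective (AdjoinRoot.root N) (by rw [map_zero]; exact h)
    exact hP ((Polynomial.map_eq_zero _).1 h')
  have key : (τ.toRingHom.comp (toCompletion θ N)).comp (algebraMap (FixedField θ)[X] _) =
      (PowerSeries.map e).comp (Polynomial.coeToPowerSeries.ringHom.comp
        (((Polynomial.taylorAlgHom (AdjoinRoot.root N)).toRingHom).comp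
          (Polynomial.mapRingHom (AdjoinRoot.of N)))) := by
    apply Polynomial.ringHom_ext
    · intro a
      have ha : algebraMap (FixedField θ)[X] (SkewLaurent θ) (Polynomial.C a) =
          SkewLaurent.const θ (a : K) := by
        change SkewLaurent.central θ (Polynomial.C a) = _
        simp [SkewLaurent.central, Polynomial.eval₂RingHom']
      simp only [RingHom.comp_apply]
      rw [ha, τ.map_const, ← ha, ← he]
      simp
    · have hX : algebraMap (FixedField θ)[X] (SkewLaurent θ) Polynomial.X = SkewLaurent.Y θ := by
        change SkewLaurent.central θ Polynomial.X = _
        simp [SkewLaurent.central, Polynomial.eval₂RingHom']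
      simp only [RingHom.comp_apply]
      rw [hX, τ.map_Y, ← hX, ← he]
      simp [add_comm]
  have hval : τ.onLaurent (algebraMap _ _ P) = HahnSeries.ofPowerSeries ℤ _
      (PowerSeries.map e (Q : PowerSeries (AdjoinRoot N))) :=
    congrArg (HahnSeries.ofPowerSeries ℤ _) (DFunLike.congr_fun key P)
  have hQ' : (Q : PowerSeries (AdjoinRoot N)) ≠ 0 := by simpa using hQ
  rw [hval, ← PowerSeries.X_pow_order_mul_divXPowOrder (f := (Q : PowerSeries (AdjoinRoot N))),
    map_mul, map_mul, map_pow, PowerSeries.map_X, map_pow, HahnSeries.ofPowerSeries_X]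
  refine IsUnit.mul (IsUnit.pow _ ?_)
    (((PowerSeries.isUnit_divided_by_X_pow_order hQ').map (PowerSeries.map e)).map _)
  exact ⟨⟨HahnSeries.single 1 1, HahnSeries.single (-1) 1, by simp, by simp⟩, rfl⟩

/-- The units `τ(D)`, for `D ∈ F[Y]`, `D ≠ 0`. -/
def denomUnits [IsSepClosure (FixedField θ) Fs] :
    nonZeroDivisors (FixedField θ)[X] →*
      (LaurentSeries (Quot θ (minpoly (FixedField θ) z)))ˣ :=
  IsUnit.liftRight (((τ.onLaurent.comp (algebraMap (FixedField θ)[X] (SkewLaurent θ)) :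
      (FixedField θ)[X] →+* _) : (FixedField θ)[X] →* _).comp
        (nonZeroDivisors (FixedField θ)[X]).subtype)
    (fun D => by exact τ.isUnit_onLaurent (nonZeroDivisors.ne_zero D.2))

/-- The extension of `τ` to `Frac(𝒵) = F(Y)`: it sends `P/D` to `τ(D)⁻¹ τ(P)`. -/
def onCentral [IsSepClosure (FixedField θ) Fs] :
    RatFunc (FixedField θ) →+* LaurentSeries (Quot θ (minpoly (FixedField θ) z)) :=
  (OreLocalization.universalHom (S := nonZeroDivisors (FixedField θ)[X])
    (τ.onLaurent.comp (algebraMap (FixedField θ)[X] (SkewLaurent θ)))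
    τ.denomUnits fun _ => rfl).comp (RatFunc.toFractionRingRingEquiv (FixedField θ) : _ →+* _)

theorem onCentral_algebraMap [IsSepClosure (FixedField θ) Fs] (P : (FixedField θ)[X]) :
    τ.onCentral (algebraMap _ _ P) = τ.onLaurent (algebraMap _ _ P) := by
  have h : RatFunc.toFractionRingRingEquiv (FixedField θ)
      (algebraMap (FixedField θ)[X] (RatFunc (FixedField θ)) P) =
        OreLocalization.numeratorHom P := by
    rw [← RatFunc.ofFractionRing_algebraMap]
    rfl
  simp only [onCentral, RingHom.comp_apply, RingHom.coe_coe]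
  rw [h]
  exact OreLocalization.universalHom_commutes _ _ _

/-- The Taylor expansion `TS_z : Frac(𝒜) → (𝒜/N𝒜)((T))` attached to the admissible morphism `τ`:
the extension of `τ` given by `D⁻¹ ⊗ g ↦ τ(D)⁻¹ τ(g)`. -/
def taylor [IsSepClosure (FixedField θ) Fs] :
    SkewFrac θ →+ LaurentSeries (Quot θ (minpoly (FixedField θ) z)) :=
  TensorProduct.liftAddHom
    ((AddMonoidHom.mul.compl₂ (τ.onLaurent : SkewLaurent θ →+ _)).comp
      (τ.onCentral : RatFunc (FixedField θ) →+ _))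
    (fun P u g => by
      change τ.onCentral (P • u) * τ.onLaurent g = τ.onCentral u * τ.onLaurent (P • g)
      rw [Algebra.smul_def, Algebra.smul_def, mul_comm, map_mul, map_mul, onCentral_algebraMap,
        mul_assoc])

theorem taylor_tmul [IsSepClosure (FixedField θ) Fs] (u : RatFunc (FixedField θ))
    (g : SkewLaurent θ) : τ.taylor (u ⊗ₜ g) = τ.onCentral u * τ.onLaurent g := rfl

/-- The skew residue `sres_z(f)` attached to the admissible morphism `τ`: the coefficient of `T⁻¹`
in the Taylor expansion of `f`. -/
def sres [IsSepClosure (FixedField θ) Fs] (f : SkewFrac θ) :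
    Quot θ (minpoly (FixedField θ) z) :=
  (τ.taylor f).coeff (-1)

end Admissible

/-- `f` has a simple pole at `z`: its Taylor expansion at `z` has `T`-adic valuation `-1` (the
valuation does not depend on the admissible morphism). -/
def HasSimplePole [IsSepClosure (FixedField θ) Fs] (z : Fs) (f : SkewFrac θ) : Prop :=
  ∃ τ : Admissible θ z, (τ.taylor f).order = -1

/-! ### Endomorphisms and regular points -/

variable {θ}

/-- `f` has no pole at `z` and its value at `z` is `x ∈ 𝒜/N𝒜`: `f` can be written `D⁻¹ g` with
`g ∈ 𝒜`, `D ∈ F[Y]`, `D(z) ≠ 0`, and `x = D⁻¹ g` in `𝒜/N𝒜`, where `N` is the minimal polynomial of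
`z`. -/
def HasValue (z : Fs) (f : SkewFrac θ) (x : Quot θ (minpoly (FixedField θ) z)) : Prop :=
  ∃ (D : (FixedField θ)[X]) (g : SkewLaurent θ), aeval z D ≠ 0 ∧
    ofLaurent θ (algebraMap _ _ D) * f = ofLaurent θ g ∧
    toQuot θ _ (algebraMap _ _ D) * x = toQuot θ _ g

/-- `f` has no pole at `z`: `f = D⁻¹ g` with `g ∈ 𝒜`, `D ∈ F[Y]` and `D(z) ≠ 0`. -/
def HasNoPole (z : Fs) (f : SkewFrac θ) : Prop :=
  ∃ (D : (FixedField θ)[X]) (g : SkewLaurent θ), aeval z D ≠ 0 ∧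
    ofLaurent θ (algebraMap _ _ D) * f = ofLaurent θ g

/-- `Z = γ(Y)`, as an element of `Frac(𝒵) = F(Y)`. -/
def imageY (γ : SkewFrac θ →+* SkewFrac θ) : RatFunc (FixedField θ) :=
  Function.invFun (ofCentral θ) (γ (ofLaurent θ (SkewLaurent.Y θ)))

/-- `z` is `γ`-regular: `Z = γ(Y)` has no zero and no pole at `Y = z`. -/
def IsRegularPoint (γ : SkewFrac θ →+* SkewFrac θ) (z : Fs) : Prop :=
  aeval z (imageY γ).num ≠ 0 ∧ aeval z (imageY γ).denom ≠ 0

/-- `γ_⋆ z`, the value of `Z = γ(Y)` at `Y = z`. -/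
def pushPoint (γ : SkewFrac θ →+* SkewFrac θ) (z : Fs) : Fs :=
  aeval z (imageY γ).num / aeval z (imageY γ).denom

/-- The derivative `d/dY` on `F(Y)`. -/
def derivY {F : Type u} [Field F] (u : RatFunc F) : RatFunc F :=
  (algebraMap F[X] (RatFunc F) (derivative u.num * u.denom - u.num * derivative u.denom)) /
    algebraMap F[X] (RatFunc F) (u.denom ^ 2)

/-- `γ` is unramified at `z`: `dγ(Y)/dY` does not vanish at `Y = z`. -/
def IsUnramifiedPoint (γ : SkewFrac θ →+* SkewFrac θ) (z : Fs) : Prop :=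
  aeval z (derivY (imageY γ)).num ≠ 0

/-- `γbar : 𝒜/N₁𝒜 → 𝒜/N₂𝒜` is the morphism induced by `γ`, where `N₁` and `N₂` are the minimal
polynomials of `γ_⋆ z` and `z`: it sends the class of `a ∈ 𝒜` to the value at `z` of `γ(a)`. -/
def IsInducedBy (γ : SkewFrac θ →+* SkewFrac θ) (z : Fs)
    (γbar : Quot θ (minpoly (FixedField θ) (pushPoint γ z)) →+*
      Quot θ (minpoly (FixedField θ) z)) : Prop :=
  ∀ a : SkewLaurent θ, HasValue z (γ (ofLaurent θ a)) (γbar (toQuot θ _ a))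

end SkewRes

end

noncomputable section

namespace SkewRes

universe u v

namespace SkewLaurent

variable {K : Type u} [Field K] (θ : RingAut K)

/-! ### Monomials, induction, and the universal property -/

/-! The formula is the invariance of residues under a change of variable, and the work lies in
making expansions compatible with that change. At $Y=z+T$ one has $\gamma(Y)=\gamma_\star z+\varphi$
with $\varphi=TU$, where $U$ is invertible because $d\gamma(Y)/dY$ does not vanish at $z$
(`exists_imageY_expansion`). Let $t$ be the substitution that applies $\bar\gamma$ to coefficients
and sends $T$ to $\varphi$. If $t$ carries the expansion of $f$ at $\gamma_\star z$ to that of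
$\gamma(f)$ at $z$, then $(\ast)$ reduces to the fact that $\varphi^{-m}\varphi'$ has residue $1$
for $m=1$ and $0$ for $m>1$ (`residue_pow_mul_derivative`, `coeff_change_of_variables`).

For this, $\tau_z$ must satisfy $\tau_z(\gamma(X))=W$ with $W=t(\tau_{\gamma_\star z}(X))$
(`exists_admissible_transport`). Write $\gamma(X)=cX$. The element $c$ centralizes $K$, and the
centralizer of $K$ in $\mathrm{Frac}(\mathcal A)$ is generated by $K$ and $F(Y)$, on which
admissible morphisms all agree; so the image of $c$ does not depend on the choice. For an arbitrary
admissible $\tau$, the series $w=\tau(\gamma(X))$ and $W$ have the same commutation with $K$, the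
same constant term and the same $r$-th power. Then $v=w^{-1}W$ commutes with $K$ and with the images
of all conjugates $X^icX^{-i}$, whose product cancels from $W^r=w^r$ to give
$(\tau(X)v)^r=\tau(X)^r=z+T$. Sending $X$ to $\tau(X)v$ defines the required $\tau_z$.

Some admissible morphism must exist at the start, even when the characteristic divides $r$: one
takes $X\mapsto(1+\alpha u)X$ with $\mathrm{Tr}\,\alpha=1$ and $u$ central, and solves for $u$ by
successive approximation (`exists_admissible`).

For (ii), $\mathcal A/N_1\mathcal A$ is simple, so $\bar\gamma$ is injective and $t$ preserves the
$T$-adic valuation. A simple pole means that $f$ has a pole at $z$ and $Nf$ has none, which does not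
involve $\tau$; the residue is then determined by the value of $Nf$, so it does not depend on $\tau$
either.

All structural facts on $\mathcal A$ (no torsion, simple quotients, centralizer, centre) come from
families $x_l,y_l\in K$ with $\sum_l x_l\theta^i(y_l)=1$ if $r\mid i$ and $0$ otherwise, given by
the independence of characters (`exists_separating`). -/

theorem monomial_add (i : ℤ) (a b : K) :
    monomial θ i (a + b) = monomial θ i a + monomial θ i b :=
  SkewMonoidAlgebra.single_add _ a b

theorem monomial_zero (i : ℤ) : monomial θ i (0 : K) = 0 :=
  SkewMonoidAlgebra.single_zero _

/-- The monomial `a Xⁱ` as an additive map in `a`. -/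
def monomialHom (i : ℤ) : K →+ SkewLaurent θ where
  toFun := monomial θ i
  map_zero' := monomial_zero θ i
  map_add' := monomial_add θ i

theorem monomial_sum {ι : Type*} (s : Finset ι) (i : ℤ) (f : ι → K) :
    monomial θ i (∑ l ∈ s, f l) = ∑ l ∈ s, monomial θ i (f l) :=
  map_sum (monomialHom θ i) f s

variable {θ}

theorem induction_monomial {p : SkewLaurent θ → Prop} (f : SkewLaurent θ)
    (hmon : ∀ (i : ℤ) (a : K), p (monomial θ i a)) (hadd : ∀ f g, p f → p g → p (f + g)) : p f :=
  SkewMonoidAlgebra.induction_on (p := fun g => p (show SkewLaurent θ from g)) f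
    (monomial_zero θ 0 ▸ hmon 0 0) (fun g a => hmon g.toAdd a) hadd

theorem addHom_ext {M : Type*} [AddZeroClass M] {f g : SkewLaurent θ →+ M}
    (h : ∀ (i : ℤ) (a : K), f (monomial θ i a) = g (monomial θ i a)) : f = g := by
  ext a
  induction a using induction_monomial with
  | hmon i a => exact h i a
  | hadd a b ha hb => rw [map_add, map_add, ha, hb]

variable (θ)

/-- The variable `X` as a unit. -/
def XUnit : (SkewLaurent θ)ˣ where
  val := X θ
  inv := monomial θ (-1) 1
  val_inv := by rw [X, monomial_mul_monomial]; simp [one_eq_monomial]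
  inv_val := by rw [X, monomial_mul_monomial]; simp [one_eq_monomial]

@[simp] theorem val_XUnit : (XUnit θ : SkewLaurent θ) = X θ := rfl

theorem val_XUnit_zpow (i : ℤ) : ((XUnit θ ^ i : (SkewLaurent θ)ˣ) : SkewLaurent θ)
    = monomial θ i 1 := by
  cases i with
  | ofNat n => simp [X_pow]
  | negSucc n =>
    rw [zpow_negSucc]
    refine Units.inv_eq_of_mul_eq_one_right ?_
    rw [Units.val_pow_eq_pow_val, val_XUnit, X_pow, monomial_mul_monomial, one_eq_monomial]
    congr 1
    · push_cast [Int.negSucc_eq]; ring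
    · simp

theorem monomial_eq (i : ℤ) (a : K) :
    monomial θ i a = const θ a * ((XUnit θ ^ i : (SkewLaurent θ)ˣ) : SkewLaurent θ) := by
  rw [val_XUnit_zpow]
  change _ = monomial θ 0 a * _
  rw [monomial_mul_monomial]; simp

theorem X_mul_const (a : K) : X θ * const θ a = const θ (θ a) * X θ := by
  change monomial θ 1 1 * monomial θ 0 a = monomial θ 0 (θ a) * monomial θ 1 1
  rw [monomial_mul_monomial, monomial_mul_monomial]; simp

theorem ringHom_ext {θ : RingAut K} {R : Type*} [Ring R] {f g : SkewLaurent θ →+* R}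
    (hc : ∀ a, f (const θ a) = g (const θ a)) (hX : f (X θ) = g (X θ)) : f = g := by
  have hu : Units.map (f : SkewLaurent θ →* R) (XUnit θ)
      = Units.map (g : SkewLaurent θ →* R) (XUnit θ) := Units.ext hX
  have : (f : SkewLaurent θ →+ R) = g := by
    refine addHom_ext fun i a => ?_
    have h1 := congrArg Units.val (congrArg (· ^ i) hu)
    simp only [← map_zpow, Units.coe_map] at h1
    simp only [AddMonoidHom.coe_coe, monomial_eq, map_mul, hc]
    congr 1
  ext a
  exact DFunLike.congr_fun this a

theorem semiconj_zpow {R : Type*} [Ring R] (k : K →+* R) (x : Rˣ)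
    (h : ∀ a, (x : R) * k a = k (θ a) * x) (i : ℤ) (a : K) :
    ((x ^ i : Rˣ) : R) * k a = k ((θ ^ i) a) * ((x ^ i : Rˣ) : R) := by
  induction i generalizing a with
  | zero => simp
  | succ n ih =>
    rw [zpow_add_one, zpow_add_one, Units.val_mul, mul_assoc, h, ← mul_assoc, ih, mul_assoc]
    rfl
  | pred n ih =>
    have h' : ∀ a, ((x⁻¹ : Rˣ) : R) * k a = k (θ⁻¹ a) * ((x⁻¹ : Rˣ) : R) := fun a => by
      rw [Units.inv_mul_eq_iff_eq_mul, ← mul_assoc, h, mul_assoc, Units.mul_inv, mul_one]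
      congr 1
      exact (θ.apply_symm_apply a).symm
    rw [zpow_sub_one, zpow_sub_one, Units.val_mul, mul_assoc, h', ← mul_assoc, ih, mul_assoc]
    rfl

/-- The universal property of skew Laurent polynomials. -/
def lift {R : Type*} [Ring R] (k : K →+* R) (x : Rˣ)
    (h : ∀ a, (x : R) * k a = k (θ a) * x) : SkewLaurent θ →+* R :=
  letI := zpowAction θ
  SkewMonoidAlgebra.liftNCRingHom (k := K) (G := Multiplicative ℤ) k
    ((Units.coeHom R).comp (zpowersHom Rˣ x))
    (fun {a y} => by exact (semiconj_zpow θ k x h y.toAdd a).symm)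

theorem lift_monomial {R : Type*} [Ring R] (k : K →+* R) (x : Rˣ)
    (h : ∀ a, (x : R) * k a = k (θ a) * x) (i : ℤ) (a : K) :
    lift θ k x h (monomial θ i a) = k a * ((x ^ i : Rˣ) : R) := by
  let := zpowAction θ
  exact SkewMonoidAlgebra.liftNC_single _ _ _ _

theorem lift_const {R : Type*} [Ring R] (k : K →+* R) (x : Rˣ)
    (h : ∀ a, (x : R) * k a = k (θ a) * x) (a : K) :
    lift θ k x h (const θ a) = k a :=
  (lift_monomial θ k x h 0 a).trans (by simp)

theorem lift_X {R : Type*} [Ring R] (k : K →+* R) (x : Rˣ)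
    (h : ∀ a, (x : R) * k a = k (θ a) * x) :
    lift θ k x h (X θ) = x :=
  (lift_monomial θ k x h 1 1).trans (by simp)

end SkewLaurent
end SkewRes

namespace SkewRes

universe u v

/-! ### Separating families and the conjugation trace -/

section Separating

variable {K : Type u} [Field K] (θ : RingAut K)

theorem zpow_eq_of_emod (i : ℤ) : θ ^ i = θ ^ (i % (orderOf θ : ℤ)) :=
  (zpow_mod_orderOf θ i).symm

theorem zpow_eq_one_of_dvd {i : ℤ} (h : (orderOf θ : ℤ) ∣ i) : θ ^ i = 1 :=
  orderOf_dvd_iff_zpow_eq_one.1 h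

/-- By linear independence of the powers of `θ`, there are families in `K` which separate them. -/
theorem exists_separating (hθ : IsOfFinOrder θ) :
    ∃ (n : ℕ) (x y : Fin n → K), ∀ i : ℤ,
      ∑ l, x l * (θ ^ i) (y l) = if (orderOf θ : ℤ) ∣ i then 1 else 0 := by
  have hr : 0 < orderOf θ := hθ.orderOf_pos
  set r := orderOf θ with hr_def
  let w : K → (Fin r → K) := fun y i => (θ ^ (i : ℕ)) y
  -- A linear form on $K^r$ that kills every vector $(\theta^i(y))_{0\le i<r}$ is a linear relation
  -- between the distinct characters $1,\theta,\dots,\theta^{r-1}$, so it is zero by Dedekind.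
  have hspan : Submodule.span K (Set.range w) = ⊤ := by
    by_contra hne
    obtain ⟨f, hf0, hf⟩ := Submodule.exists_le_ker_of_lt_top _ (lt_top_iff_ne_top.2 hne)
    have hli : LinearIndependent K (fun i : Fin r => (fun y => (θ ^ (i : ℕ)) y : K → K)) := by
      have h := (linearIndependent_monoidHom K K).comp
        (fun i : Fin r => (((θ ^ (i : ℕ) : RingAut K) : K →+* K) : K →* K)) (fun i j hij => by
          have h1 : θ ^ (i : ℕ) = θ ^ (j : ℕ) := by
            ext a; exact DFunLike.congr_fun hij a
          exact Fin.ext (pow_injOn_Iio_orderOf i.2 j.2 h1))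
      exact h
    have h0 := Fintype.linearIndependent_iff.1 hli (fun i => f (Pi.single i 1)) (by
      ext y
      have h1 : f (w y) = 0 := hf (Submodule.subset_span ⟨y, rfl⟩)
      rw [LinearMap.pi_apply_eq_sum_univ] at h1
      simp only [Finset.sum_apply, Pi.smul_apply, smul_eq_mul, Pi.zero_apply]
      rw [← h1]
      refine Finset.sum_congr rfl fun i _ => ?_
      rw [smul_eq_mul, mul_comm]
      congr 2
      ext j
      simp [Pi.single_apply, eq_comm])
    refine hf0 (LinearMap.ext fun v => ?_)
    rw [LinearMap.pi_apply_eq_sum_univ]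
    refine Finset.sum_eq_zero fun i _ => ?_
    have : (fun j => if i = j then (1 : K) else 0) = Pi.single i 1 := by
      ext j
      simp [Pi.single_apply, eq_comm]
    rw [this, h0 i, smul_zero]
  -- The two families are the coefficients and the vectors in an expression of the first basis
  -- vector.
  have hmem : (Pi.single ⟨0, hr⟩ 1 : Fin r → K) ∈ Submodule.span K (Set.range w) :=
    hspan ▸ Submodule.mem_top
  obtain ⟨n, x, g, hg⟩ := Submodule.mem_span_set'.1 hmem
  choose y hy using fun l => (g l).2
  refine ⟨n, x, y, fun i => ?_⟩
  have hi0 : 0 ≤ i % (r : ℤ) := Int.emod_nonneg _ (by exact_mod_cast hr.ne')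
  have hi1 : i % (r : ℤ) < r := Int.emod_lt_of_pos _ (by exact_mod_cast hr)
  obtain ⟨m, hm⟩ := Int.eq_ofNat_of_zero_le hi0
  have hmr : m < r := by omega
  have h := congrFun hg ⟨m, hmr⟩
  simp only [Finset.sum_apply, Pi.smul_apply, smul_eq_mul, ← hy] at h
  rw [zpow_eq_of_emod, ← hr_def, hm, zpow_natCast]
  refine h.trans ?_
  rw [Pi.single_apply]
  congr 1
  rw [Int.dvd_iff_emod_eq_zero, hm, Fin.mk_eq_mk]
  simp

theorem mem_fixedField {c : K} : c ∈ FixedField θ ↔ θ c = c := Iff.rfl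

theorem fixedField_zpow (c : FixedField θ) (i : ℤ) : (θ ^ i) (c : K) = c := by
  have h : θ ∈ MulAction.stabilizer (RingAut K) (c : K) := c.2
  exact (MulAction.stabilizer (RingAut K) (c : K)).zpow_mem h i

/-- The sum over a period is invariant. -/
theorem trace_mem_fixedField (a : K) :
    ∑ k ∈ Finset.range (orderOf θ), (θ ^ k) a ∈ FixedField θ := by
  rw [mem_fixedField, map_sum]
  have h : ∀ k, θ ((θ ^ k) a) = (θ ^ (k + 1)) a := fun k => by rw [pow_succ']; rfl
  simp only [h]
  have h1 := Finset.sum_range_succ (fun k => (θ ^ k) a) (orderOf θ)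
  rw [Finset.sum_range_succ', pow_orderOf_eq_one, pow_zero] at h1
  exact add_right_cancel h1

/-- If the trace vanished on every $y_l$, summing the separating relations over one period would
give $1=0$. Dividing some $y_l$ by its nonzero trace, which $\theta$ fixes, yields $\alpha$. -/
theorem exists_trace_eq_one (hθ : IsOfFinOrder θ) :
    ∃ α : K, ∑ k ∈ Finset.range (orderOf θ), (θ ^ k) α = 1 := by
  obtain ⟨n, x, y, h⟩ := exists_separating θ hθ
  have h1 : ∃ l, ∑ k ∈ Finset.range (orderOf θ), (θ ^ k) (y l) ≠ 0 := by
    by_contra! hne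
    have h2 : ∑ k ∈ Finset.range (orderOf θ), ∑ l, x l * (θ ^ (k : ℤ)) (y l) = 0 := by
      rw [Finset.sum_comm]
      refine Finset.sum_eq_zero fun l _ => ?_
      rw [← Finset.mul_sum]
      simp only [zpow_natCast, hne, mul_zero]
    simp only [h] at h2
    rw [Finset.sum_eq_single_of_mem 0 (Finset.mem_range.2 hθ.orderOf_pos)] at h2
    · simp at h2
    · intro k hk hk0
      refine if_neg fun hd => hk0 ?_
      exact Nat.eq_zero_of_dvd_of_lt (by exact_mod_cast hd) (Finset.mem_range.1 hk)
  obtain ⟨l, hl⟩ := h1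
  set t := ∑ k ∈ Finset.range (orderOf θ), (θ ^ k) (y l) with ht
  have htF : t ∈ FixedField θ := trace_mem_fixedField θ _
  have hfix : ∀ k : ℕ, (θ ^ k) t = t := fun k => by
    simpa using fixedField_zpow θ ⟨t, htF⟩ k
  refine ⟨y l / t, ?_⟩
  simp only [map_div₀, hfix, ← Finset.sum_div]
  rw [← ht, div_self hl]

end Separating

/-! ### Projecting $\mathcal A$ onto $F[Y^{\pm1}]$ and recovering elements from their projections -/

namespace SkewLaurent

variable {K : Type u} [Field K] {θ : RingAut K}

theorem const_mul_monomial (a : K) (i : ℤ) (b : K) :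
    const θ a * monomial θ i b = monomial θ i (a * b) := by
  change monomial θ 0 a * _ = _
  rw [monomial_mul_monomial]; simp

theorem monomial_mul_const (i : ℤ) (b a : K) :
    monomial θ i b * const θ a = monomial θ i (b * (θ ^ i) a) := by
  change _ * monomial θ 0 a = _
  rw [monomial_mul_monomial]; simp

variable (θ) in
/-- The operator `a ↦ ∑ xₗ a yₗ`. -/
def sandwich {n : ℕ} (x y : Fin n → K) : SkewLaurent θ →+ SkewLaurent θ :=
  ∑ l, (AddMonoidHom.mulLeft (const θ (x l))).comp (AddMonoidHom.mulRight (const θ (y l)))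

theorem sandwich_apply {n : ℕ} (x y : Fin n → K) (a : SkewLaurent θ) :
    sandwich θ x y a = ∑ l, const θ (x l) * (a * const θ (y l)) := by
  simp [sandwich]

/-- Moving $y_l$ across $X^i$ turns it into $\theta^i(y_l)$; the separating relation makes the
operator the projection onto exponents divisible by $r$. -/
theorem sandwich_monomial {n : ℕ} {x y : Fin n → K} (h : ∀ i : ℤ,
      ∑ l, x l * (θ ^ i) (y l) = if (orderOf θ : ℤ) ∣ i then 1 else 0) (i : ℤ) (b : K) :
    sandwich θ x y (monomial θ i b) = if (orderOf θ : ℤ) ∣ i then monomial θ i b else 0 := by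
  simp only [sandwich_apply, monomial_mul_const, const_mul_monomial]
  rw [← monomial_sum]
  have : ∑ l, x l * (b * (θ ^ i) (y l)) = b * ∑ l, x l * (θ ^ i) (y l) := by
    rw [Finset.mul_sum]; exact Finset.sum_congr rfl fun l _ => by ring
  rw [this, h]
  split_ifs
  · rw [mul_one]
  · rw [mul_zero, monomial_zero]

variable (θ) in
/-- The operator `a ↦ ∑ Xᵏ a X⁻ᵏ`, the sum being over `0 ≤ k < r`. -/
def conjTrace : SkewLaurent θ →+ SkewLaurent θ :=
  ∑ k ∈ Finset.range (orderOf θ), (AddMonoidHom.mulLeft (monomial θ k 1)).comp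
    (AddMonoidHom.mulRight (monomial θ (-k) 1))

theorem conjTrace_apply (a : SkewLaurent θ) :
    conjTrace θ a = ∑ k ∈ Finset.range (orderOf θ),
      monomial θ k 1 * (a * monomial θ (-k) 1) := by
  simp [conjTrace]

theorem conjTrace_monomial (i : ℤ) (b : K) :
    conjTrace θ (monomial θ i b) =
      monomial θ i (∑ k ∈ Finset.range (orderOf θ), (θ ^ k) b) := by
  rw [conjTrace_apply, monomial_sum]
  refine Finset.sum_congr rfl fun k _ => ?_
  rw [monomial_mul_monomial, monomial_mul_monomial]
  simp

variable (θ) in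
/-- The additive subgroup of the elements of `𝒜` of the form `Y⁻ⁿ P(Y)`. -/
def centralLaurent : AddSubgroup (SkewLaurent θ) where
  carrier := {c | ∃ (n : ℕ) (P : (FixedField θ)[X]), Y θ ^ n * c = algebraMap _ _ P}
  zero_mem' := ⟨0, 0, by simp⟩
  add_mem' := by
    rintro a b ⟨n, P, h⟩ ⟨m, Q, h'⟩
    have hY : algebraMap (FixedField θ)[X] (SkewLaurent θ) Polynomial.X = Y θ := by
      change central θ Polynomial.X = _
      simp [central, Polynomial.eval₂RingHom']
    refine ⟨n + m, Polynomial.X ^ m * P + Polynomial.X ^ n * Q, ?_⟩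
    rw [map_add, map_mul, map_mul, ← h, ← h', map_pow, map_pow, hY, mul_add, ← mul_assoc,
      ← mul_assoc, ← pow_add, ← pow_add, add_comm m n]
  neg_mem' := by
    rintro a ⟨n, P, h⟩
    exact ⟨n, -P, by rw [mul_neg, h, map_neg]⟩

@[simp] theorem algebraMap_X : algebraMap (FixedField θ)[X] (SkewLaurent θ) Polynomial.X = Y θ := by
  change central θ Polynomial.X = _
  simp [central, Polynomial.eval₂RingHom']

@[simp] theorem algebraMap_C (c : FixedField θ) :
    algebraMap (FixedField θ)[X] (SkewLaurent θ) (Polynomial.C c) = const θ (c : K) := by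
  change central θ (Polynomial.C c) = _
  simp [central, Polynomial.eval₂RingHom']

theorem Y_pow_eq_monomial (n : ℕ) : Y θ ^ n = monomial θ (orderOf θ * n) 1 := by
  rw [Y, ← pow_mul, X_pow]; push_cast; rfl

theorem isUnit_Y : IsUnit (Y θ) := (XUnit θ ^ orderOf θ).isUnit

theorem monomial_mem_centralLaurent {i : ℤ} (hi : (orderOf θ : ℤ) ∣ i) {b : K}
    (hb : b ∈ FixedField θ) : monomial θ i b ∈ centralLaurent θ := by
  obtain ⟨m, rfl⟩ := hi
  refine ⟨m.natAbs, Polynomial.C ⟨b, hb⟩ * Polynomial.X ^ (m + m.natAbs).toNat, ?_⟩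
  have h0 : 0 ≤ m + m.natAbs := by omega
  rw [map_mul, map_pow, algebraMap_X, algebraMap_C, Y_pow_eq_monomial, Y_pow_eq_monomial,
    monomial_mul_monomial, const_mul_monomial, Int.toNat_of_nonneg h0,
    zpow_eq_one_of_dvd θ (Dvd.intro _ rfl)]
  congr 1
  · ring
  · simp

/-- The projection keeps the powers of $Y$, and conjugation by powers of $X$ replaces their
coefficients by traces, which lie in $F$. -/
theorem conjTrace_sandwich_mem {n : ℕ} {x y : Fin n → K} (h : ∀ i : ℤ,
      ∑ l, x l * (θ ^ i) (y l) = if (orderOf θ : ℤ) ∣ i then 1 else 0) (c : K)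
    (a : SkewLaurent θ) :
    conjTrace θ (const θ c * sandwich θ x y a) ∈ centralLaurent θ := by
  induction a using induction_monomial with
  | hmon i b =>
    rw [sandwich_monomial h]
    split_ifs with hi
    · rw [const_mul_monomial, conjTrace_monomial]
      exact monomial_mem_centralLaurent hi (trace_mem_fixedField θ _)
    · rw [mul_zero, map_zero]; exact zero_mem _
  | hadd a b ha hb => rw [map_add, mul_add, map_add]; exact add_mem ha hb

/-- The families are dual for the trace form: $\sum_l x_l\,\mathrm{Tr}(y_lb)=b$, by expanding the
trace and exchanging the sums. -/
theorem sum_conjTrace_monomial (hθ : IsOfFinOrder θ) {n : ℕ} {x y : Fin n → K} (h : ∀ i : ℤ,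
      ∑ l, x l * (θ ^ i) (y l) = if (orderOf θ : ℤ) ∣ i then 1 else 0) (m : ℤ) (b : K) :
    ∑ l, const θ (x l) * conjTrace θ (const θ (y l) * monomial θ m b) = monomial θ m b := by
  have hr := hθ.orderOf_pos
  simp only [const_mul_monomial, conjTrace_monomial]
  rw [← monomial_sum]
  congr 1
  simp only [Finset.mul_sum, map_mul]
  rw [Finset.sum_comm]
  have h1 : ∀ k ∈ Finset.range (orderOf θ), ∑ l, x l * ((θ ^ k) (y l) * (θ ^ k) b) =
      if k = 0 then b else 0 := by
    intro k hk
    have h2 : ∑ l, x l * ((θ ^ k) (y l) * (θ ^ k) b) =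
        (∑ l, x l * (θ ^ (k : ℤ)) (y l)) * (θ ^ k) b := by
      rw [Finset.sum_mul, zpow_natCast]; exact Finset.sum_congr rfl fun l _ => by ring
    rw [h2, h]
    split_ifs with h3 h4 h4
    · subst h4; simp
    · exact absurd (Nat.eq_zero_of_dvd_of_lt (by exact_mod_cast h3) (Finset.mem_range.1 hk)) h4
    · subst h4; simp at h3
    · simp
  rw [Finset.sum_congr rfl h1, Finset.sum_ite_eq' _ 0, if_pos (Finset.mem_range.2 hr)]

theorem sum_conjTrace_sandwich (hθ : IsOfFinOrder θ) {n : ℕ} {x y : Fin n → K} (h : ∀ i : ℤ,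
      ∑ l, x l * (θ ^ i) (y l) = if (orderOf θ : ℤ) ∣ i then 1 else 0) (a : SkewLaurent θ) :
    ∑ l, const θ (x l) * conjTrace θ (const θ (y l) * sandwich θ x y a) = sandwich θ x y a := by
  induction a using induction_monomial with
  | hmon i b =>
    rw [sandwich_monomial h]
    split_ifs with hi
    · exact sum_conjTrace_monomial hθ h i b
    · simp
  | hadd a b ha hb => simp only [map_add, mul_add, Finset.sum_add_distrib, ha, hb]

/-- Every element of `𝒜` is an explicit combination of central elements of the two-sided ideal it
generates. -/
theorem decomposition (hθ : IsOfFinOrder θ) {n : ℕ} {x y : Fin n → K} (h : ∀ i : ℤ,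
      ∑ l, x l * (θ ^ i) (y l) = if (orderOf θ : ℤ) ∣ i then 1 else 0) (a : SkewLaurent θ) :
    a = ∑ i ∈ Finset.range (orderOf θ), ∑ l, const θ (x l) *
      conjTrace θ (const θ (y l) * sandwich θ x y (a * monomial θ (-i) 1)) * monomial θ i 1 := by
  have hr := hθ.orderOf_pos
  induction a using induction_monomial with
  | hmon j b =>
    have hmem : (j % (orderOf θ : ℤ)).toNat ∈ Finset.range (orderOf θ) := by
      have := Int.emod_lt_of_pos j (b := orderOf θ) (by exact_mod_cast hr)
      have := Int.emod_nonneg j (b := orderOf θ) (by exact_mod_cast hr.ne')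
      rw [Finset.mem_range]; omega
    have hto : ((j % (orderOf θ : ℤ)).toNat : ℤ) = j % (orderOf θ : ℤ) :=
      Int.toNat_of_nonneg (Int.emod_nonneg j (by exact_mod_cast hr.ne'))
    simp only [monomial_mul_monomial, sandwich_monomial h, map_one, mul_one, ← Finset.sum_mul]
    -- Among the shifts by $X^{-i}$ with $0\le i<r$, only $i\equiv j$ brings the exponent $j$ to a
    -- multiple of $r$; the projection kills the others.
    rw [Finset.sum_eq_single_of_mem _ hmem]
    · have hd : (orderOf θ : ℤ) ∣ j + -((j % (orderOf θ : ℤ)).toNat : ℤ) := by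
        rw [hto, ← sub_eq_add_neg]; exact Int.dvd_self_sub_emod
      simp only [if_pos hd]
      rw [sum_conjTrace_monomial hθ h, monomial_mul_monomial]
      simp
    · intro i hi hne
      have hd : ¬ (orderOf θ : ℤ) ∣ j + -(i : ℤ) := by
        intro hd
        refine hne ?_
        have h2 : j % (orderOf θ : ℤ) = i % (orderOf θ : ℤ) :=
          Int.emod_eq_emod_iff_emod_sub_eq_zero.2
            (Int.emod_eq_zero_of_dvd (by simpa [sub_eq_add_neg] using hd))
        rw [Int.emod_eq_of_lt (a := i) (by positivity)
          (by exact_mod_cast Finset.mem_range.1 hi)] at h2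
        omega
      simp only [if_neg hd, mul_zero, map_zero, zero_mul, Finset.sum_const_zero]
  | hadd a b ha hb =>
    simp only [add_mul, map_add, mul_add, Finset.sum_add_distrib]
    rw [← ha, ← hb]

end SkewLaurent
end SkewRes

namespace SkewRes

universe u v

/-! ### Torsion and the residue rings -/

namespace SkewLaurent

variable {K : Type u} [Field K] {θ : RingAut K}

/-- Combine an $F$-linear retraction $K\to F$ with $Y^m\mapsto w^m$, dropping exponents not
divisible by $r$; $w\ne0$ is needed for negative $m$. Such a functional detects that elements are
nonzero: it is applied with $w$ transcendental for injectivity of $F[Y]\to\mathcal A$, and with $w$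
a root of $N$ for $\mathcal A/N\mathcal A\ne0$. -/
theorem exists_evalFunctional (hθ : IsOfFinOrder θ) {L : Type*} [Field L]
    [Algebra (FixedField θ) L] {w : L} (hw : w ≠ 0) :
    ∃ Λ : SkewLaurent θ →+ L, Λ 1 = 1 ∧
      ∀ (P : (FixedField θ)[X]) (g : SkewLaurent θ),
        Λ (algebraMap _ _ P * g) = aeval w P * Λ g := by
  have hr : (orderOf θ : ℤ) ≠ 0 := by exact_mod_cast hθ.orderOf_pos.ne'
  obtain ⟨t, ht⟩ := LinearMap.exists_leftInverse_of_injective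
    (Algebra.linearMap (FixedField θ) K)
    (LinearMap.ker_eq_bot.2 (algebraMap (FixedField θ) K).injective)
  let G : Multiplicative ℤ → L :=
    fun i => if (orderOf θ : ℤ) ∣ i.toAdd then w ^ (i.toAdd / (orderOf θ : ℤ)) else 0
  let Λ : SkewLaurent θ →+ L := SkewMonoidAlgebra.liftNC
    ((algebraMap (FixedField θ) L : _ →+ L).comp (t : K →+ FixedField θ)) G
  have hΛ : ∀ (i : ℤ) (a : K), Λ (monomial θ i a) = algebraMap _ L (t a) *
      if (orderOf θ : ℤ) ∣ i then w ^ (i / (orderOf θ : ℤ)) else 0 :=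
    fun i a => SkewMonoidAlgebra.liftNC_single _ _ _ _
  refine ⟨Λ, ?_, fun P g => ?_⟩
  · have h1 : t 1 = 1 := by simpa using LinearMap.congr_fun ht 1
    rw [one_eq_monomial, hΛ, h1]; simp
  · induction P using Polynomial.induction_on' with
    | add P Q hP hQ => rw [map_add, map_add, add_mul, add_mul, map_add, hP, hQ]
    | monomial n c =>
      induction g using induction_monomial with
      | hmon i a =>
        have h2 : algebraMap (FixedField θ)[X] (SkewLaurent θ) (Polynomial.monomial n c) *
            monomial θ i a = monomial θ (orderOf θ * n + i) (c * a) := by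
          rw [← Polynomial.C_mul_X_pow_eq_monomial, map_mul, map_pow, algebraMap_C, algebraMap_X,
            Y_pow_eq_monomial, mul_assoc, monomial_mul_monomial, const_mul_monomial,
            zpow_eq_one_of_dvd θ (Dvd.intro _ rfl)]
          simp
        have h3 : t ((c : K) * a) = c * t a := by
          rw [show (c : K) * a = c • a from rfl, map_smul, smul_eq_mul]
        have h4 : ((orderOf θ : ℤ) ∣ orderOf θ * n + i) ↔ (orderOf θ : ℤ) ∣ i :=
          Int.dvd_add_right (Dvd.intro _ rfl)
        rw [h2, hΛ, hΛ, h3, Polynomial.aeval_monomial, map_mul]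
        simp only [h4]
        split_ifs with hd
        · obtain ⟨m, rfl⟩ := hd
          rw [← mul_add, Int.mul_ediv_cancel_left _ hr, Int.mul_ediv_cancel_left _ hr,
            zpow_add₀ hw, zpow_natCast]
          ring
        · simp
      | hadd a b ha hb => rw [mul_add, map_add, map_add, ha, hb, mul_add]

theorem algebraMap_injective (hθ : IsOfFinOrder θ) :
    Function.Injective (algebraMap (FixedField θ)[X] (SkewLaurent θ)) := by
  refine (injective_iff_map_eq_zero _).2 fun P hP => ?_
  obtain ⟨Λ, h1, h⟩ := exists_evalFunctional hθ (RatFunc.X_ne_zero (K := FixedField θ))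
  have h2 := h P 1
  rw [hP, zero_mul, map_zero, h1, mul_one, RatFunc.aeval_X_left_eq_algebraMap] at h2
  exact RatFunc.algebraMap_injective _ (by rw [← h2, map_zero])

theorem commute_algebraMap (P : (FixedField θ)[X]) (a : SkewLaurent θ) :
    Commute (algebraMap _ (SkewLaurent θ) P) a := Algebra.commutes P a

theorem sandwich_algebraMap_mul {n : ℕ} (x y : Fin n → K) (P : (FixedField θ)[X])
    (a : SkewLaurent θ) :
    sandwich θ x y (algebraMap _ _ P * a) = algebraMap _ _ P * sandwich θ x y a := by
  rw [sandwich_apply, sandwich_apply, Finset.mul_sum]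
  refine Finset.sum_congr rfl fun l _ => ?_
  rw [← mul_assoc, ← mul_assoc, ← (commute_algebraMap P _).eq, mul_assoc, mul_assoc]

theorem conjTrace_algebraMap_mul (P : (FixedField θ)[X]) (a : SkewLaurent θ) :
    conjTrace θ (algebraMap _ _ P * a) = algebraMap _ _ P * conjTrace θ a := by
  rw [conjTrace_apply, conjTrace_apply, Finset.mul_sum]
  refine Finset.sum_congr rfl fun l _ => ?_
  rw [← mul_assoc, ← mul_assoc, ← (commute_algebraMap P _).eq, mul_assoc, mul_assoc]

/-- `𝒜` is torsion-free over `F[Y]`. -/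
theorem eq_zero_of_algebraMap_mul (hθ : IsOfFinOrder θ) {D : (FixedField θ)[X]} (hD : D ≠ 0)
    {a : SkewLaurent θ} (h : algebraMap _ _ D * a = 0) : a = 0 := by
  obtain ⟨n, x, y, hxy⟩ := exists_separating θ hθ
  rw [decomposition hθ hxy a]
  refine Finset.sum_eq_zero fun i _ => Finset.sum_eq_zero fun l _ => ?_
  obtain ⟨m, P, hP⟩ := conjTrace_sandwich_mem hxy (y l) (a * monomial θ (-i) 1)
  set c := conjTrace θ (const θ (y l) * sandwich θ x y (a * monomial θ (-i) 1)) with hc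
  -- The operators are $F[Y]$-linear, so $D$ kills the component $c$ too; up to a power of $Y$, $c$
  -- lies in the domain $F[Y]$.
  have h1 : algebraMap _ _ D * c = 0 := by
    rw [hc, ← conjTrace_algebraMap_mul, ← mul_assoc, (commute_algebraMap D _).eq, mul_assoc,
      ← sandwich_algebraMap_mul, ← mul_assoc, h]
    simp
  have h2 : D * P = 0 := by
    apply algebraMap_injective hθ
    rw [map_mul, ← hP, ← mul_assoc, (commute_algebraMap D _).eq, mul_assoc, h1, map_zero, mul_zero]
  have h3 : c = 0 := by
    rw [(mul_eq_zero.1 h2).resolve_left hD, map_zero] at hP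
    exact (isUnit_Y.pow m).mul_right_eq_zero.1 hP
  rw [h3]; simp

end SkewLaurent

open SkewLaurent

variable {K : Type u} [Field K] {θ : RingAut K}

theorem toQuot_eq_zero_iff {N : (FixedField θ)[X]} {a : SkewLaurent θ} :
    toQuot θ N a = 0 ↔ ∃ b, a = algebraMap _ _ N * b := by
  rw [Ideal.Quotient.eq_zero_iff_mem, centralIdeal, Ideal.mem_span_singleton']
  exact ⟨fun ⟨b, hb⟩ => ⟨b, by rw [← hb, (commute_algebraMap N b).eq]⟩,
    fun ⟨b, hb⟩ => ⟨b, by rw [hb, (commute_algebraMap N b).eq]⟩⟩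

theorem toQuot_self (N : (FixedField θ)[X]) : toQuot θ N (algebraMap _ _ N) = 0 :=
  toQuot_eq_zero_iff.2 ⟨1, (mul_one _).symm⟩

theorem quot_nontrivial (hθ : IsOfFinOrder θ) {L : Type*} [Field L]
    [Algebra (FixedField θ) L] {w : L} (hw : w ≠ 0) :
    Nontrivial (Quot θ (minpoly (FixedField θ) w)) := by
  refine ⟨⟨1, 0, fun h => ?_⟩⟩
  obtain ⟨b, hb⟩ := toQuot_eq_zero_iff.1 (show toQuot θ _ 1 = 0 by rw [map_one]; exact h)
  obtain ⟨Λ, h1, h2⟩ := exists_evalFunctional hθ hw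
  rw [hb, h2, minpoly.aeval, zero_mul] at h1
  exact zero_ne_one h1

/-- `𝒜/N𝒜` is a simple ring when `N` is irreducible. -/
theorem quot_ringHom_injective (hθ : IsOfFinOrder θ) {N : (FixedField θ)[X]} (hN : Irreducible N)
    {R : Type*} [Ring R] [Nontrivial R] (f : Quot θ N →+* R) : Function.Injective f := by
  refine (injective_iff_map_eq_zero f).2 fun a ha => ?_
  obtain ⟨a, rfl⟩ := Ideal.Quotient.mk_surjective a
  obtain ⟨n, x, y, hxy⟩ := exists_separating θ hθ
  rw [decomposition hθ hxy a, map_sum]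
  refine Finset.sum_eq_zero fun i _ => ?_
  rw [map_sum]
  refine Finset.sum_eq_zero fun l _ => ?_
  obtain ⟨m, P, hP⟩ := conjTrace_sandwich_mem hxy (y l) (a * monomial θ (-i) 1)
  set c := conjTrace θ (const θ (y l) * sandwich θ x y (a * monomial θ (-i) 1)) with hc
  -- The component $c$ lies in the two-sided ideal generated by $a$, hence is killed along with it.
  have h1 : f (toQuot θ N c) = 0 := by
    rw [hc, conjTrace_apply, map_sum, map_sum]
    refine Finset.sum_eq_zero fun k _ => ?_
    have h2 : f (toQuot θ N (sandwich θ x y (a * monomial θ (-i) 1))) = 0 := by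
      rw [sandwich_apply, map_sum, map_sum]
      refine Finset.sum_eq_zero fun k _ => ?_
      simp only [map_mul, ha, zero_mul, mul_zero]
    simp only [map_mul, h2, zero_mul, mul_zero]
  have h3 : f (toQuot θ N (algebraMap _ _ P)) = 0 := by rw [← hP, map_mul, map_mul, h1, mul_zero]
  -- Otherwise a Bézout relation between $N$ and $P$ would map to $1=0$ in $R$.
  have h4 : N ∣ P := by
    by_contra hd
    obtain ⟨u, v, huv⟩ := (hN.coprime_iff_not_dvd.2 hd)
    have h5 := congrArg (fun Q => f (toQuot θ N (algebraMap _ _ Q))) huv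
    simp only [map_add, map_mul, map_one, h3, toQuot_self, map_zero, mul_zero, add_zero] at h5
    exact zero_ne_one h5
  obtain ⟨Q, rfl⟩ := h4
  have h5 : toQuot θ N c = 0 := by
    have h6 := congrArg (toQuot θ N) hP
    rw [map_mul, map_mul, map_mul, toQuot_self, zero_mul] at h6
    exact ((isUnit_Y.pow m).map (toQuot θ N)).mul_right_eq_zero.1 h6
  rw [map_mul, map_mul, h5, mul_zero, zero_mul]

/-! ### The fraction ring -/

theorem smul_eq_algebraMap_mul (D : (FixedField θ)[X]) (a : SkewLaurent θ) :
    D • a = algebraMap _ _ D * a := Algebra.smul_def D a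

theorem ofLaurent_apply (a : SkewLaurent θ) : ofLaurent θ a = 1 ⊗ₜ a := rfl
theorem ofCentral_apply (u : RatFunc (FixedField θ)) : ofCentral θ u = u ⊗ₜ 1 := rfl

theorem ofCentral_mul_ofLaurent (u : RatFunc (FixedField θ)) (a : SkewLaurent θ) :
    ofCentral θ u * ofLaurent θ a = u ⊗ₜ a := by
  rw [ofLaurent_apply, ofCentral_apply, Algebra.TensorProduct.tmul_mul_tmul, mul_one, one_mul]

theorem ofLaurent_algebraMap (D : (FixedField θ)[X]) :
    ofLaurent θ (algebraMap _ _ D) = ofCentral θ (algebraMap _ _ D) := by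
  rw [ofLaurent_apply, ofCentral_apply, Algebra.algebraMap_eq_smul_one,
    Algebra.algebraMap_eq_smul_one, TensorProduct.smul_tmul]

theorem ofCentral_commute (u : RatFunc (FixedField θ)) (f : SkewFrac θ) :
    Commute (ofCentral θ u) f := by
  induction f using TensorProduct.induction_on with
  | zero => exact Commute.zero_right _
  | tmul v a =>
    rw [ofCentral_apply, Commute, SemiconjBy, Algebra.TensorProduct.tmul_mul_tmul,
      Algebra.TensorProduct.tmul_mul_tmul, mul_comm, mul_one, one_mul]
  | add f g hf hg => exact hf.add_right hg

/-- The kernel of a localization map consists of torsion elements, and $\mathcal A$ has no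
$F[Y]$-torsion. -/
theorem ofLaurent_injective (hθ : IsOfFinOrder θ) : Function.Injective (ofLaurent θ) := by
  refine (injective_iff_map_eq_zero _).2 fun a ha => ?_
  have hloc : IsLocalizedModule (nonZeroDivisors (FixedField θ)[X])
      (TensorProduct.mk (FixedField θ)[X] (RatFunc (FixedField θ)) (SkewLaurent θ) 1) :=
    (isLocalizedModule_iff_isBaseChange (nonZeroDivisors (FixedField θ)[X])
      (RatFunc (FixedField θ)) _).2 (TensorProduct.isBaseChange _ _ _)
  obtain ⟨D, hD⟩ := (IsLocalizedModule.eq_zero_iff (nonZeroDivisors (FixedField θ)[X])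
    (TensorProduct.mk (FixedField θ)[X] (RatFunc (FixedField θ)) (SkewLaurent θ) 1)).1 ha
  exact eq_zero_of_algebraMap_mul hθ (nonZeroDivisors.ne_zero D.2)
    ((smul_eq_algebraMap_mul _ _).symm.trans hD)

theorem isUnit_ofLaurent_algebraMap {D : (FixedField θ)[X]} (hD : D ≠ 0) :
    IsUnit (ofLaurent θ (algebraMap _ _ D)) := by
  rw [ofLaurent_algebraMap]
  exact (IsUnit.mk0 _ (RatFunc.algebraMap_ne_zero hD)).map (ofCentral θ)

theorem exists_denominator (f : SkewFrac θ) : ∃ (D : (FixedField θ)[X]) (g : SkewLaurent θ),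
    D ≠ 0 ∧ ofLaurent θ (algebraMap _ _ D) * f = ofLaurent θ g := by
  induction f using TensorProduct.induction_on with
  | zero => exact ⟨1, 0, one_ne_zero, by simp⟩
  | tmul u a =>
    refine ⟨u.denom, algebraMap _ _ u.num * a, u.denom_ne_zero, ?_⟩
    rw [← ofCentral_mul_ofLaurent, map_mul, ofLaurent_algebraMap, ofLaurent_algebraMap,
      ← mul_assoc, ← map_mul]
    congr 2
    have h := RatFunc.num_div_denom u
    rw [div_eq_iff (RatFunc.algebraMap_ne_zero u.denom_ne_zero)] at h
    rw [h, mul_comm]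
  | add f f' hf hf' =>
    obtain ⟨D, g, hD, h⟩ := hf
    obtain ⟨D', g', hD', h'⟩ := hf'
    refine ⟨D * D', algebraMap _ _ D' * g + algebraMap _ _ D * g', mul_ne_zero hD hD', ?_⟩
    rw [map_add (ofLaurent θ), map_mul (ofLaurent θ) _ g, map_mul (ofLaurent θ) _ g', ← h, ← h',
      mul_add, ← mul_assoc, ← mul_assoc, ← map_mul, ← map_mul, ← map_mul, ← map_mul, mul_comm D' D]

end SkewRes

namespace SkewRes

universe u v

/-! ### Centralizers and endomorphisms -/

open SkewLaurent

variable {K : Type u} [Field K] {θ : RingAut K}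

/-- If $g$ commutes with $K$, the operator multiplies it by $\sum_l x_ly_l$, which is $1$ by the
separating relation at $i=0$. -/
theorem sandwich_eq_self {n : ℕ} {x y : Fin n → K} (h : ∀ i : ℤ,
      ∑ l, x l * (θ ^ i) (y l) = if (orderOf θ : ℤ) ∣ i then 1 else 0) {g : SkewLaurent θ}
    (hg : ∀ a, Commute (const θ a) g) : sandwich θ x y g = g := by
  have h0 : ∑ l, x l * y l = 1 := (h 0).trans (if_pos (dvd_zero _))
  rw [sandwich_apply]
  have (l : Fin n) : const θ (x l) * (g * const θ (y l)) = const θ (x l * y l) * g := by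
    rw [← (hg (y l)).eq, ← mul_assoc, map_mul]
  simp only [this]
  rw [← Finset.sum_mul, ← map_sum, h0, map_one, one_mul]

theorem ofLaurent_centralLaurent {c : SkewLaurent θ} (hc : c ∈ centralLaurent θ) :
    ∃ u, ofLaurent θ c = ofCentral θ u := by
  obtain ⟨n, P, hP⟩ := hc
  refine ⟨algebraMap (FixedField θ)[X] _ P / algebraMap (FixedField θ)[X] _ (Polynomial.X ^ n), ?_⟩
  have hX : (Polynomial.X ^ n : (FixedField θ)[X]) ≠ 0 := pow_ne_zero _ Polynomial.X_ne_zero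
  refine (isUnit_ofLaurent_algebraMap hX).mul_left_cancel ?_
  rw [← map_mul, map_pow, algebraMap_X, hP, ← algebraMap_X, ← map_pow, ofLaurent_algebraMap,
    ofLaurent_algebraMap, ← map_mul, mul_div_cancel₀ _ (RatFunc.algebraMap_ne_zero hX)]

theorem eq_ofCentral_inv_mul {f : SkewFrac θ} {D : (FixedField θ)[X]} {g : SkewLaurent θ}
    (hD : D ≠ 0) (h : ofLaurent θ (algebraMap _ _ D) * f = ofLaurent θ g) :
    f = ofCentral θ (algebraMap _ _ D)⁻¹ * ofLaurent θ g := by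
  rw [← h, ofLaurent_algebraMap, ← mul_assoc, ← map_mul,
    inv_mul_cancel₀ (RatFunc.algebraMap_ne_zero hD), map_one, one_mul]

/-- The centralizer of `K` in `Frac(𝒜)` is generated by `K` and `F(Y)`. -/
theorem mem_closure_of_commute_const (hθ : IsOfFinOrder θ) {f : SkewFrac θ}
    (hf : ∀ a, Commute (ofLaurent θ (const θ a)) f) :
    f ∈ Subring.closure (Set.range (fun a => ofLaurent θ (const θ a)) ∪
      Set.range (ofCentral θ)) := by
  obtain ⟨D, g, hD, h⟩ := exists_denominator f
  obtain ⟨n, x, y, hxy⟩ := exists_separating θ hθ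
  have hg : ∀ a, Commute (const θ a) g := fun a => by
    apply ofLaurent_injective hθ
    rw [map_mul, map_mul, ← h]
    have h1 : Commute (ofLaurent θ (const θ a)) (ofLaurent θ (algebraMap _ _ D)) :=
      ((commute_algebraMap D (const θ a)).map (ofLaurent θ)).symm
    exact h1.mul_right (hf a)
  rw [eq_ofCentral_inv_mul hD h, ← sandwich_eq_self hxy hg, ← sum_conjTrace_sandwich hθ hxy g,
    map_sum]
  refine mul_mem (Subring.subset_closure (Or.inr ⟨_, rfl⟩)) (sum_mem fun l _ => ?_)
  rw [map_mul]
  obtain ⟨u, hu⟩ := ofLaurent_centralLaurent (conjTrace_sandwich_mem hxy (y l) g)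
  exact mul_mem (Subring.subset_closure (Or.inl ⟨_, rfl⟩))
    (hu ▸ Subring.subset_closure (Or.inr ⟨_, rfl⟩))

/-- The center of `Frac(𝒜)` is `F(Y)`. -/
theorem exists_eq_ofCentral (hθ : IsOfFinOrder θ) {f : SkewFrac θ}
    (hf : ∀ a, Commute (ofLaurent θ (const θ a)) f) (hX : Commute (ofLaurent θ (X θ)) f) :
    ∃ u, f = ofCentral θ u := by
  obtain ⟨D, g, hD, h⟩ := exists_denominator f
  obtain ⟨n, x, y, hxy⟩ := exists_separating θ hθ
  obtain ⟨α, hα⟩ := exists_trace_eq_one θ hθ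
  have hcomm : ∀ b, Commute (ofLaurent θ b) f → Commute b g := fun b hb => by
    apply ofLaurent_injective hθ
    rw [map_mul, map_mul, ← h]
    have h1 : Commute (ofLaurent θ b) (ofLaurent θ (algebraMap _ _ D)) :=
      ((commute_algebraMap D b).map (ofLaurent θ)).symm
    exact h1.mul_right hb
  have hg : ∀ a, Commute (const θ a) g := fun a => hcomm _ (hf a)
  have hgX : Commute g (XUnit θ : SkewLaurent θ) := (hcomm _ hX).symm
  -- Since $g$ commutes with $X$, the conjugates of $\alpha g$ sum to $\mathrm{Tr}(\alpha)g=g$, so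
  -- $g$ is itself one of the central components.
  have h1 : conjTrace θ (const θ α * sandwich θ x y g) = g := by
    rw [sandwich_eq_self hxy hg, conjTrace_apply]
    have h2 : ∀ k : ℕ, monomial θ k 1 * (const θ α * g * monomial θ (-k) 1) =
        const θ ((θ ^ k) α) * g := fun k => by
      rw [← val_XUnit_zpow θ (-k : ℤ), mul_assoc, (hgX.units_zpow_right (-k : ℤ)).eq,
        val_XUnit_zpow, ← mul_assoc, ← mul_assoc, monomial_mul_const, SkewLaurent.monomial_mul_monomial]
      simp [const]
      rfl
    rw [Finset.sum_congr rfl fun k _ => h2 k, ← Finset.sum_mul, ← map_sum, hα, map_one, one_mul]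
  obtain ⟨u, hu⟩ := ofLaurent_centralLaurent (conjTrace_sandwich_mem hxy α g)
  rw [h1] at hu
  exact ⟨(algebraMap _ _ D)⁻¹ * u, by rw [eq_ofCentral_inv_mul hD h, hu, map_mul]⟩

/-- An element commuting with the images of `K` and `F(Y)` commutes with the image of the
centralizer of `K`. -/
theorem commute_map_of_commute_const (hθ : IsOfFinOrder θ) {R : Type*} [Ring R]
    (Φ : SkewFrac θ →+* R) {f : SkewFrac θ} (hf : ∀ a, Commute (ofLaurent θ (const θ a)) f) {v : R}
    (hv : ∀ a, Commute (Φ (ofLaurent θ (const θ a))) v)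
    (hv' : ∀ u, Commute (Φ (ofCentral θ u)) v) : Commute (Φ f) v := by
  have hmem := mem_closure_of_commute_const hθ hf
  clear hf
  induction hmem using Subring.closure_induction with
  | mem x hx =>
    rcases hx with ⟨a, rfl⟩ | ⟨u, rfl⟩
    · exact hv a
    · exact hv' u
  | zero => rw [map_zero]; exact Commute.zero_left _
  | one => rw [map_one]; exact Commute.one_left _
  | add x y _ _ hx hy => rw [map_add]; exact hx.add_left hy
  | neg x _ hx => rw [map_neg]; exact hx.neg_left
  | mul x y _ _ hx hy => rw [map_mul]; exact hx.mul_left hy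

/-- Two morphisms which agree on `K` and on `F(Y)` agree on the centralizer of `K`. -/
theorem map_eq_of_commute_const (hθ : IsOfFinOrder θ) {R : Type*} [Ring R]
    {Φ Ψ : SkewFrac θ →+* R} {f : SkewFrac θ} (hf : ∀ a, Commute (ofLaurent θ (const θ a)) f)
    (h : ∀ a, Φ (ofLaurent θ (const θ a)) = Ψ (ofLaurent θ (const θ a)))
    (h' : ∀ u, Φ (ofCentral θ u) = Ψ (ofCentral θ u)) : Φ f = Ψ f := by
  refine RingHom.eqOn_set_closure ?_ (mem_closure_of_commute_const hθ hf)
  rintro x (⟨a, rfl⟩ | ⟨u, rfl⟩)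
  · exact h a
  · exact h' u

/-- The powers of `c x` when `x` permutes cyclically the conjugates of `c`. -/
theorem mul_pow_eq_prod_mul_pow {R : Type*} [Ring R] {c : ℕ → R} {x : R}
    (h : ∀ i, x * c i = c (i + 1) * x) (n : ℕ) :
    (c 0 * x) ^ n = ((List.range n).map c).prod * x ^ n := by
  have h1 : ∀ n, x ^ n * c 0 = c n * x ^ n := fun n => by
    induction n with
    | zero => simp
    | succ n ih => rw [pow_succ', mul_assoc, ih, ← mul_assoc, h, mul_assoc]
  induction n with
  | zero => simp
  | succ n ih =>
    rw [pow_succ, ih, List.range_succ, List.map_append, List.prod_append, mul_assoc, ← mul_assoc _ _ x,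
      h1, mul_assoc, ← pow_succ]
    simp [mul_assoc]

/-! ### The images of $X$ and $Y$ under an endomorphism over $K$ -/

section Endomorphism

variable (γ : SkewFrac θ →+* SkewFrac θ)

theorem endo_X_mul_const
    (hγ : ∀ a : K, γ (ofLaurent θ (const θ a)) = ofLaurent θ (const θ a)) (a : K) :
    γ (ofLaurent θ (X θ)) * ofLaurent θ (const θ a) =
    ofLaurent θ (const θ (θ a)) * γ (ofLaurent θ (X θ)) := by
  rw [← hγ a, ← hγ (θ a), ← map_mul, ← map_mul, X_mul_const, map_mul, map_mul]

theorem ofLaurent_X_inv : ofLaurent θ (monomial θ (-1) 1) * ofLaurent θ (X θ) = 1 := by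
  rw [← map_mul]
  exact (congrArg _ (XUnit θ).inv_mul).trans (map_one _)

theorem ofLaurent_X_inv' : ofLaurent θ (X θ) * ofLaurent θ (monomial θ (-1) 1) = 1 := by
  rw [← map_mul]
  exact (congrArg _ (XUnit θ).mul_inv).trans (map_one _)

/-- `γ(X) X⁻¹`. -/
def twist : SkewFrac θ := γ (ofLaurent θ (X θ)) * ofLaurent θ (monomial θ (-1) 1)

theorem twist_mul_X : twist γ * ofLaurent θ (X θ) = γ (ofLaurent θ (X θ)) := by
  rw [twist, mul_assoc, ofLaurent_X_inv, mul_one]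

theorem isUnit_ofLaurent_X : IsUnit (ofLaurent θ (X θ)) :=
  (XUnit θ).isUnit.map (ofLaurent θ)

theorem isUnit_twist : IsUnit (twist γ) :=
  (isUnit_ofLaurent_X.map γ).mul ((XUnit θ)⁻¹.isUnit.map (ofLaurent θ))

/-- The elements `Xⁱ γ(X) X⁻¹ X⁻ⁱ`. -/
def twistConj (i : ℕ) : SkewFrac θ :=
  ofLaurent θ (X θ) ^ i * twist γ * ofLaurent θ (monomial θ (-1) 1) ^ i

theorem twistConj_zero : twistConj γ 0 = twist γ := by simp [twistConj]

theorem X_mul_twistConj (i : ℕ) :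
    ofLaurent θ (X θ) * twistConj γ i = twistConj γ (i + 1) * ofLaurent θ (X θ) := by
  simp only [twistConj, mul_assoc]
  rw [pow_succ (ofLaurent θ (monomial θ (-1) 1)), mul_assoc, ofLaurent_X_inv, mul_one,
    pow_succ' _ i, mul_assoc]

theorem X_inv_mul_const (a : K) :
    ofLaurent θ (monomial θ (-1) 1) * ofLaurent θ (const θ (θ a)) =
      ofLaurent θ (const θ a) * ofLaurent θ (monomial θ (-1) 1) := by
  rw [← map_mul, ← map_mul, monomial_mul_const, const_mul_monomial]
  simp

/-- Right multiplication by $X^{-1}$ undoes the twist by $\theta$, turning a semilinear element into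
one that centralizes $K$. -/
theorem commute_const_mul_X_inv {f : SkewFrac θ}
    (h : ∀ a, f * ofLaurent θ (const θ a) = ofLaurent θ (const θ (θ a)) * f) (a : K) :
    Commute (ofLaurent θ (const θ a)) (f * ofLaurent θ (monomial θ (-1) 1)) := by
  obtain ⟨b, rfl⟩ := θ.surjective a
  rw [Commute, SemiconjBy, ← mul_assoc, ← h, mul_assoc, mul_assoc, X_inv_mul_const]

theorem twist_commute_const
    (hγ : ∀ a : K, γ (ofLaurent θ (const θ a)) = ofLaurent θ (const θ a)) (a : K) :
    Commute (ofLaurent θ (const θ a)) (twist γ) :=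
  commute_const_mul_X_inv (endo_X_mul_const γ hγ) a

theorem twistConj_commute_const
    (hγ : ∀ a : K, γ (ofLaurent θ (const θ a)) = ofLaurent θ (const θ a)) (i : ℕ) (a : K) :
    Commute (ofLaurent θ (const θ a)) (twistConj γ i) := by
  induction i generalizing a with
  | zero => rw [twistConj_zero]; exact twist_commute_const γ hγ a
  | succ i ih =>
    have h : twistConj γ (i + 1) = ofLaurent θ (X θ) * twistConj γ i *
        ofLaurent θ (monomial θ (-1) 1) := by
      rw [X_mul_twistConj, mul_assoc, ofLaurent_X_inv', mul_one]
    rw [h]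
    refine commute_const_mul_X_inv (fun a => ?_) a
    rw [mul_assoc, ← (ih a).eq, ← mul_assoc, ← map_mul, X_mul_const, map_mul, mul_assoc]

/-- `γ(Y)` belongs to `F(Y)`. -/
theorem ofCentral_imageY (hθ : IsOfFinOrder θ)
    (hγ : ∀ a : K, γ (ofLaurent θ (const θ a)) = ofLaurent θ (const θ a)) :
    ofCentral θ (imageY γ) = γ (ofLaurent θ (Y θ)) := by
  have hc : ∀ a, Commute (ofLaurent θ (const θ a)) (γ (ofLaurent θ (Y θ))) := fun a => by
    rw [← hγ]
    exact ((Y_commute θ (const θ a)).map (ofLaurent θ)).map γ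
  -- Commutation with $X$ is deduced from $\gamma(X)=cX$: $\gamma(Y)$ commutes with $\gamma(X)$, and
  -- with $c$ because $c$ is generated by $K$ and $F(Y)$; the unit $c$ cancels.
  obtain ⟨u, hu⟩ := exists_eq_ofCentral hθ hc (by
    have h1 : Commute (twist γ) (γ (ofLaurent θ (Y θ))) :=
      commute_map_of_commute_const hθ (RingHom.id _) (twist_commute_const γ hγ) hc
        fun u => ofCentral_commute u _
    have h2 : Commute (γ (ofLaurent θ (X θ))) (γ (ofLaurent θ (Y θ))) :=
      ((Y_commute θ (X θ)).map (ofLaurent θ)).map γ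
    refine (isUnit_twist γ).mul_left_cancel ?_
    rw [← mul_assoc, twist_mul_X, h2.eq, ← twist_mul_X, ← mul_assoc, ← h1.eq, mul_assoc])
  exact Function.invFun_eq ⟨u, hu.symm⟩

end Endomorphism

end SkewRes

namespace SkewRes

universe u v

/-! ### Power series: extension of morphisms, substitution, residues -/

section PowerSeries

theorem X_pow_dvd_mul_left {S : Type*} [Ring S] {m : ℕ} {p : PowerSeries S} (q : PowerSeries S)
    (h : PowerSeries.X ^ m ∣ p) : PowerSeries.X ^ m ∣ q * p := by
  obtain ⟨c, rfl⟩ := h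
  exact ⟨q * c, by rw [← mul_assoc, ((PowerSeries.commute_X q).pow_right m).eq, mul_assoc]⟩

theorem X_pow_dvd_pow {S : Type*} [Ring S] {p : PowerSeries S}
    (h : PowerSeries.constantCoeff p = 0) (m : ℕ) : PowerSeries.X ^ m ∣ p ^ m := by
  obtain ⟨c, rfl⟩ := PowerSeries.X_dvd_iff.2 h
  exact ⟨c ^ m, (PowerSeries.commute_X c).symm.mul_pow m⟩

theorem X_pow_succ_dvd_X_mul_iff {S : Type*} [Ring S] {m : ℕ} {p : PowerSeries S} :
    PowerSeries.X ^ (m + 1) ∣ PowerSeries.X * p ↔ PowerSeries.X ^ m ∣ p := by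
  rw [pow_succ']
  constructor
  · rintro ⟨c, hc⟩
    rw [mul_assoc] at hc
    exact ⟨c, PowerSeries.X_mul_cancel hc⟩
  · rintro ⟨c, rfl⟩
    exact ⟨c, by rw [mul_assoc]⟩

/-- Extension of a morphism with values in power series to a completion. -/
theorem exists_extension {A R S : Type*} [Ring A] [Ring R] [Ring S] (ι : A →+* R)
    (J : ℕ → Ideal R) [∀ m, (J m).IsTwoSided] (hJ : Antitone J)
    (hdense : ∀ x m, ∃ a, x - ι a ∈ J m) (σ : A →+* PowerSeries S)
    (hσ : ∀ a m, ι a ∈ J m → PowerSeries.X ^ m ∣ σ a) :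
    ∃ t : R →+* PowerSeries S, (∀ a, t (ι a) = σ a) := by
  choose a ha using hdense
  let t : R → PowerSeries S := fun x => PowerSeries.mk fun k => PowerSeries.coeff k (σ (a x (k + 1)))
  -- The coefficient of index $k$ is read on an approximation modulo $J_{k+1}$; any approximation
  -- modulo $J_m$ with $m>k$ gives the same one. Hence sums and products of approximations compute
  -- sums and products.
  have key : ∀ x b m, x - ι b ∈ J m → ∀ k < m, PowerSeries.coeff k (t x) = PowerSeries.coeff k (σ b) := by
    intro x b m h k hk
    have h1 : ι (a x (k + 1) - b) ∈ J (k + 1) := by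
      have h2 := (J (k + 1)).sub_mem (hJ (Nat.succ_le_of_lt hk) h) (ha x (k + 1))
      rw [map_sub]
      convert h2 using 1
      abel
    have h3 := PowerSeries.X_pow_dvd_iff.1 (hσ _ _ h1) k (Nat.lt_succ_self k)
    rw [map_sub, map_sub, sub_eq_zero] at h3
    rw [PowerSeries.coeff_mk, h3]
  have hext : ∀ x (p : PowerSeries S), (∀ m, ∃ b, x - ι b ∈ J m ∧ ∀ k < m, PowerSeries.coeff k p = PowerSeries.coeff k (σ b)) →
      t x = p := by
    intro x p h
    ext k
    obtain ⟨b, hb, hk⟩ := h (k + 1)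
    rw [hk k (Nat.lt_succ_self k), key x b _ hb k (Nat.lt_succ_self k)]
  have hι : ∀ b, t (ι b) = σ b := fun b => hext _ _ fun m => ⟨b, by simp, fun _ _ => rfl⟩
  refine ⟨⟨⟨⟨t, ?_⟩, ?_⟩, ?_, ?_⟩, hι⟩
  · rw [← map_one ι, hι, map_one]
  · intro x y
    refine hext _ _ fun m => ⟨a x m * a y m, ?_, fun k hk => ?_⟩
    · have h : x * y - ι (a x m * a y m) = (x - ι (a x m)) * y + ι (a x m) * (y - ι (a y m)) := by
        rw [map_mul]; noncomm_ring
      rw [h]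
      exact (J m).add_mem ((J m).mul_mem_right _ (ha x m)) ((J m).mul_mem_left _ (ha y m))
    · rw [map_mul σ, PowerSeries.coeff_mul, PowerSeries.coeff_mul]
      refine Finset.sum_congr rfl fun ij hij => ?_
      have := Finset.HasAntidiagonal.mem_antidiagonal.1 hij
      rw [key x _ m (ha x m) _ (by omega), key y _ m (ha y m) _ (by omega)]
  · have := hι 0
    rwa [map_zero, map_zero] at this
  · intro x y
    refine hext _ _ fun m => ⟨a x m + a y m, ?_, fun k hk => ?_⟩
    · have h : x + y - ι (a x m + a y m) = (x - ι (a x m)) + (y - ι (a y m)) := by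
        rw [map_add]; abel
      rw [h]
      exact (J m).add_mem (ha x m) (ha y m)
    · rw [map_add, map_add, map_add, key x _ m (ha x m) k hk, key y _ m (ha y m) k hk]

instance {S : Type*} [Ring S] (m : ℕ) :
    (Ideal.span {(PowerSeries.X : PowerSeries S) ^ m}).IsTwoSided :=
  ⟨fun {a} b ha => by
    obtain ⟨c, rfl⟩ := Ideal.mem_span_singleton'.1 ha
    exact Ideal.mem_span_singleton'.2 ⟨c * b, by
      rw [mul_assoc, mul_assoc, ((PowerSeries.commute_X b).pow_right m).eq]⟩⟩

theorem mem_span_X_pow {S : Type*} [Ring S] {m : ℕ} {p : PowerSeries S} :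
    p ∈ Ideal.span {(PowerSeries.X : PowerSeries S) ^ m} ↔ PowerSeries.X ^ m ∣ p := by
  rw [Ideal.mem_span_singleton']
  exact ⟨fun ⟨c, hc⟩ => ⟨c, by rw [← hc, ((PowerSeries.commute_X c).pow_right m).eq]⟩,
    fun ⟨c, hc⟩ => ⟨c, by rw [hc, ((PowerSeries.commute_X c).pow_right m).eq]⟩⟩

/-- The substitution `T ↦ φ`, for `φ` central and without constant term. -/
theorem exists_substitution {B₁ B₂ : Type*} [Ring B₁] [Ring B₂] (g : B₁ →+* B₂)
    (φ : PowerSeries B₂) (hφ : ∀ q, Commute q φ) (h0 : PowerSeries.constantCoeff φ = 0) :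
    ∃ t : PowerSeries B₁ →+* PowerSeries B₂, (∀ b, t (PowerSeries.C b) = PowerSeries.C (g b)) ∧
      t PowerSeries.X = φ := by
  let σ : Polynomial B₁ →+* PowerSeries B₂ :=
    Polynomial.eval₂RingHom' (PowerSeries.C.comp g) φ fun a => hφ _
  obtain ⟨t, ht⟩ := exists_extension (Polynomial.coeToPowerSeries.ringHom (R := B₁))
    (fun m => Ideal.span {(PowerSeries.X : PowerSeries B₁) ^ m})
    (fun m n hmn => Ideal.span_le.2 (Set.singleton_subset_iff.2
      (mem_span_X_pow.2 (pow_dvd_pow _ hmn))))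
    (fun x m => ⟨PowerSeries.trunc m x, mem_span_X_pow.2 (PowerSeries.X_pow_dvd_iff.2
      fun k hk => by simp [PowerSeries.coeff_trunc, hk])⟩) σ
    (fun a m ha => by
      have h1 := PowerSeries.X_pow_dvd_iff.1 (mem_span_X_pow.1 ha)
      obtain ⟨b, rfl⟩ := Polynomial.X_pow_dvd_iff.2 (fun d hd => by simpa using h1 d hd)
      rw [map_mul, map_pow]
      obtain ⟨c, hc⟩ := X_pow_dvd_pow h0 m
      refine ⟨c * σ b, ?_⟩
      have : σ Polynomial.X = φ := by simp [σ]
      rw [this, hc, mul_assoc])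
  refine ⟨t, fun b => ?_, ?_⟩
  · simpa [σ] using ht (Polynomial.C b)
  · simpa [σ] using ht Polynomial.X

/-- Differentiating $V^{n+1}$ gives this identity multiplied by $n+1$. To divide in any
characteristic, lift $V$ to a series over a polynomial ring with integer coefficients, where $n+1$
is cancellable, and specialize. -/
theorem coeff_pow_eq_coeff_pow_mul_derivative {R : Type*} [CommRing R] (V : PowerSeries R) (n : ℕ) :
    PowerSeries.coeff (n + 1) (V ^ (n + 1)) = PowerSeries.coeff n (V ^ n * PowerSeries.derivative R V) := by
  let π : MvPolynomial R ℤ →+* R := (MvPolynomial.aeval (R := ℤ) (id : R → R)).toRingHom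
  have hπ : ∀ r, π (MvPolynomial.X r) = r := fun r => by simp [π]
  let W : PowerSeries (MvPolynomial R ℤ) := PowerSeries.mk fun k => MvPolynomial.X (PowerSeries.coeff k V)
  have hW : PowerSeries.map π W = V := by
    ext k
    simp [W, hπ]
  have hdW : PowerSeries.map π (PowerSeries.derivative _ W) = PowerSeries.derivative R V := by
    ext k
    rw [← hW]
    simp [PowerSeries.coeff_derivative]
  have h1 := congrArg (PowerSeries.coeff n) (PowerSeries.derivative_pow W (n + 1))
  rw [PowerSeries.coeff_derivative, Nat.add_sub_cancel, mul_assoc,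
    show ((n + 1 : ℕ) : PowerSeries (MvPolynomial R ℤ)) = PowerSeries.C ((n + 1 : ℕ) : MvPolynomial R ℤ)
      by simp, PowerSeries.coeff_C_mul, mul_comm] at h1
  have h2 : ((n + 1 : ℕ) : MvPolynomial R ℤ) ≠ 0 := Nat.cast_ne_zero.2 n.succ_ne_zero
  have h3 := mul_left_cancel₀ h2 (by push_cast at h1 ⊢; exact h1)
  have h4 := congrArg π h3
  rwa [← PowerSeries.coeff_map, ← PowerSeries.coeff_map, map_pow (PowerSeries.map π),
    map_mul (PowerSeries.map π), map_pow (PowerSeries.map π), hW, hdW] at h4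

/-- The residue of `φ⁻ᵏ⁻¹ dφ`, where `φ = T / V`. -/
theorem residue_pow_mul_derivative {R : Type*} [CommRing R] {U V : PowerSeries R} (h : U * V = 1)
    (k : ℕ) : PowerSeries.coeff k (V ^ (k + 1) * PowerSeries.derivative R (PowerSeries.X * U)) =
      if k = 0 then 1 else 0 := by
  have hd : PowerSeries.derivative R (PowerSeries.X * U) =
      U + PowerSeries.X * PowerSeries.derivative R U := by
    rw [Derivation.leibniz, PowerSeries.derivative_X]
    simp [add_comm]
  have hUV : V * PowerSeries.derivative R U = - (U * PowerSeries.derivative R V) := by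
    have := Derivation.leibniz (PowerSeries.derivative R) U V
    rw [h, PowerSeries.derivative_one, smul_eq_mul, smul_eq_mul] at this
    linear_combination -this
  cases k with
  | zero =>
    have : V ^ (0 + 1) * PowerSeries.derivative R (PowerSeries.X * U) =
        1 + PowerSeries.X * (V * PowerSeries.derivative R U) := by
      rw [hd]; linear_combination h
    rw [this]; simp
  | succ k =>
    -- Since $VU'=-UV'$, this is the identity $V^{k+2}(TU)'=V^{k+1}-TV^kV'$, whose coefficient of
    -- index $k+1$ vanishes by the preceding lemma.
    have : V ^ (k + 1 + 1) * PowerSeries.derivative R (PowerSeries.X * U) =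
        V ^ (k + 1) - PowerSeries.X * (V ^ k * PowerSeries.derivative R V) := by
      rw [hd]
      linear_combination (V ^ (k + 1)) * h + PowerSeries.X * V ^ (k + 1) * hUV -
        PowerSeries.X * V ^ k * PowerSeries.derivative R V * h
    rw [this, map_sub, PowerSeries.coeff_succ_X_mul, coeff_pow_eq_coeff_pow_mul_derivative, sub_self,
      if_neg k.succ_ne_zero]

theorem exists_C_add_X_mul {S : Type*} [Ring S] (p : PowerSeries S) :
    ∃ q, p = PowerSeries.C (PowerSeries.coeff 0 p) + PowerSeries.X * q ∧ ∀ k, PowerSeries.coeff k q = PowerSeries.coeff (k + 1) p := by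
  refine ⟨PowerSeries.mk fun k => PowerSeries.coeff (k + 1) p, ?_, fun k => by simp⟩
  ext k
  cases k with
  | zero => simp
  | succ k => simp [PowerSeries.coeff_succ_X_mul]

/-! ### Residues and valuations under the substitution $T\mapsto TU$ -/

section Subst

variable {B₁ B₂ E : Type*} [Ring B₁] [Ring B₂] [CommRing E] {g : B₁ →+* B₂} {e : E →+* B₂}
  {t : PowerSeries B₁ →+* PowerSeries B₂} {U V : PowerSeries E}

theorem commute_map_powerSeries (he : ∀ c b, Commute (e c) b) (p : PowerSeries E)
    (q : PowerSeries B₂) : Commute (PowerSeries.map e p) q := by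
  ext n
  rw [PowerSeries.coeff_mul, PowerSeries.coeff_mul, ← Finset.Nat.sum_antidiagonal_swap]
  refine Finset.sum_congr rfl fun ij _ => ?_
  simp only [Prod.fst_swap, Prod.snd_swap, PowerSeries.coeff_map]
  exact he _ _

/-- Invariance of residues under the change of variables `φ = T U`, with `V = U⁻¹`. -/
theorem coeff_change_of_variables
    (hC : ∀ b, t (PowerSeries.C b) = PowerSeries.C (g b))
    (hX : t PowerSeries.X = PowerSeries.map e (PowerSeries.X * U)) (h : U * V = 1) (m : ℕ)
    (p : PowerSeries B₁) :
    PowerSeries.coeff m (PowerSeries.map e (V ^ (m + 1) * PowerSeries.derivative E (PowerSeries.X * U)) * t p) =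
      g (PowerSeries.coeff m p) := by
  have hres := fun k => residue_pow_mul_derivative h k
  set d := PowerSeries.derivative E (PowerSeries.X * U)
  induction m generalizing p with
  | zero =>
    obtain ⟨q, hq, -⟩ := exists_C_add_X_mul p
    have h0 := hres 0
    rw [if_pos rfl, PowerSeries.coeff_zero_eq_constantCoeff_apply] at h0
    rw [PowerSeries.coeff_zero_eq_constantCoeff_apply,
      PowerSeries.coeff_zero_eq_constantCoeff_apply] at *
    rw [map_mul PowerSeries.constantCoeff]
    have h1 : PowerSeries.constantCoeff (PowerSeries.map e (V ^ (0 + 1) * d)) = 1 := by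
      rw [← PowerSeries.coeff_zero_eq_constantCoeff_apply, PowerSeries.coeff_map, PowerSeries.coeff_zero_eq_constantCoeff_apply, h0,
        map_one]
    rw [h1, one_mul]
    conv_lhs => rw [hq, map_add, map_mul, hC, hX]
    simp
  | succ m ih =>
    obtain ⟨q, hq, hqc⟩ := exists_C_add_X_mul p
    -- With $p=b+Tq$, the constant $b$ contributes the residue of $\varphi^{-m-2}\varphi'$, which is
    -- zero, while the factor $t(T)=TU$ in front of $t(q)$ absorbs one $V$ and lowers the exponent.
    have h1 : PowerSeries.map e (V ^ (m + 1 + 1) * d) * t p =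
        PowerSeries.map e (V ^ (m + 1 + 1) * d) * PowerSeries.C (g (PowerSeries.coeff 0 p)) +
          PowerSeries.X * (PowerSeries.map e (V ^ (m + 1) * d) * t q) := by
      conv_lhs => rw [hq, map_add, map_mul t, hC, hX, mul_add, ← mul_assoc, ← map_mul]
      congr 1
      have : V ^ (m + 1 + 1) * d * (PowerSeries.X * U) = PowerSeries.X * (V ^ (m + 1) * d) := by
        linear_combination (V ^ (m + 1) * d * PowerSeries.X) * h
      rw [this, map_mul, PowerSeries.map_X, mul_assoc]
    rw [h1, map_add, PowerSeries.coeff_succ_X_mul, ih, hqc, PowerSeries.coeff_mul_C, PowerSeries.coeff_map, hres,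
      if_neg m.succ_ne_zero, map_zero, zero_mul, zero_add]

theorem X_pow_dvd_unit_mul_iff (h : U * V = 1) (n m : ℕ)
    (q : PowerSeries B₂) :
    PowerSeries.X ^ m ∣ PowerSeries.map e U ^ n * q ↔ PowerSeries.X ^ m ∣ q := by
  refine ⟨fun hd => ?_, fun hd => X_pow_dvd_mul_left _ hd⟩
  have h1 := X_pow_dvd_mul_left (PowerSeries.map e V ^ n) hd
  rwa [← mul_assoc, ← map_pow, ← map_pow, ← map_mul, ← mul_pow, mul_comm V, h, one_pow, map_one,
    one_mul] at h1

/-- The constant term becomes its image under the injective map $g$, so it vanishes exactly when it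
did before; then one factor $T$ is removed on each side, the unit $U$ being harmless. -/
theorem X_pow_dvd_subst_iff (hg : Function.Injective g)
    (hC : ∀ b, t (PowerSeries.C b) = PowerSeries.C (g b))
    (hX : t PowerSeries.X = PowerSeries.map e (PowerSeries.X * U)) (h : U * V = 1) (m : ℕ)
    (p : PowerSeries B₁) : PowerSeries.X ^ m ∣ t p ↔ PowerSeries.X ^ m ∣ p := by
  have hX' : t PowerSeries.X = PowerSeries.X * PowerSeries.map e U := by
    rw [hX, map_mul, PowerSeries.map_X]
  induction m generalizing p with
  | zero => simp
  | succ m ih =>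
    obtain ⟨q, hq, hqc⟩ := exists_C_add_X_mul p
    have key : PowerSeries.coeff 0 p = 0 → (PowerSeries.X ^ (m + 1) ∣ t p ↔ PowerSeries.X ^ (m + 1) ∣ p) := by
      intro h0
      rw [h0, map_zero, zero_add] at hq
      rw [hq, map_mul, hX', mul_assoc, X_pow_succ_dvd_X_mul_iff,
        X_pow_succ_dvd_X_mul_iff, ← propext (ih q)]
      simpa using X_pow_dvd_unit_mul_iff h 1 m (t q)
    constructor
    · intro hd
      refine (key ?_).1 hd
      have h1 := PowerSeries.X_pow_dvd_iff.1 hd 0 m.succ_pos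
      rw [hq, map_add, map_mul, hC, hX', map_add, mul_assoc, PowerSeries.coeff_zero_X_mul, add_zero,
        PowerSeries.coeff_zero_C] at h1
      exact hg (h1.trans (map_zero g).symm)
    · intro hd
      exact (key (PowerSeries.X_pow_dvd_iff.1 hd 0 m.succ_pos)).2 hd

end Subst

end PowerSeries

end SkewRes

namespace SkewRes

universe u v

/-! ### Laurent series -/

section Laurent

variable {B : Type*} [Ring B]

/-- The inclusion of power series into Laurent series. -/
abbrev ofPS : PowerSeries B →+* LaurentSeries B := HahnSeries.ofPowerSeries ℤ B

theorem ofPS_injective : Function.Injective (ofPS (B := B)) := HahnSeries.ofPowerSeries_injective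

theorem isUnit_ofPS_X : IsUnit (ofPS (PowerSeries.X : PowerSeries B)) := by
  rw [ofPS, HahnSeries.ofPowerSeries_X]
  exact ⟨⟨HahnSeries.single 1 1, HahnSeries.single (-1) 1, by simp, by simp⟩, rfl⟩

theorem coeff_ofPS_X_pow_mul (m : ℕ) (L : LaurentSeries B) (i : ℤ) :
    (ofPS PowerSeries.X ^ m * L).coeff i = L.coeff (i - m) := by
  rw [ofPS, HahnSeries.ofPowerSeries_X, HahnSeries.single_pow, HahnSeries.coeff_single_mul]
  simp

theorem coeff_ofPS_nat (p : PowerSeries B) (n : ℕ) :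
    (ofPS p).coeff (n : ℤ) = PowerSeries.coeff n p := by
  rw [ofPS, PowerSeries.coeff_coe, if_neg (by omega)]; simp

theorem coeff_ofPS_neg (p : PowerSeries B) {i : ℤ} (hi : i < 0) : (ofPS p).coeff i = 0 := by
  rw [ofPS, PowerSeries.coeff_coe, if_pos hi]

theorem exists_X_pow_mul_eq_ofPS (L : LaurentSeries B) :
    ∃ (m : ℕ) (p : PowerSeries B), ofPS PowerSeries.X ^ m * L = ofPS p := by
  have hL := LaurentSeries.single_order_mul_powerSeriesPart L
  refine ⟨(-L.order).toNat, PowerSeries.X ^ (L.order + (-L.order).toNat).toNat *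
    L.powerSeriesPart, ?_⟩
  conv_lhs => rw [← hL]
  rw [map_mul, map_pow, ofPS, HahnSeries.ofPowerSeries_X, HahnSeries.single_pow,
    HahnSeries.single_pow, ← mul_assoc, HahnSeries.single_mul_single]
  congr 3
  · simp; omega
  · simp

theorem commute_ofPS_of_commute {c : PowerSeries B} (hc : ∀ p, Commute c p) (L : LaurentSeries B) :
    Commute (ofPS c) L := by
  obtain ⟨m, p, h⟩ := exists_X_pow_mul_eq_ofPS L
  refine (isUnit_ofPS_X.pow m).mul_left_cancel ?_
  have h1 : Commute (ofPS PowerSeries.X ^ m) (ofPS c) :=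
    ((PowerSeries.commute_X c).map ofPS).symm.pow_left m
  rw [← mul_assoc, h1.eq, mul_assoc, h, ← mul_assoc, h, ← map_mul, ← map_mul, (hc p).eq]

theorem mem_range_ofPS_iff {L : LaurentSeries B} {m : ℕ} {p : PowerSeries B}
    (h : ofPS PowerSeries.X ^ m * L = ofPS p) : L ∈ (ofPS (B := B)).range ↔ PowerSeries.X ^ m ∣ p := by
  constructor
  · rintro ⟨q, rfl⟩
    rw [← map_pow, ← map_mul] at h
    exact ⟨q, (ofPS_injective h).symm⟩
  · rintro ⟨q, rfl⟩
    rw [map_mul, map_pow] at h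
    exact ⟨q, ((isUnit_ofPS_X.pow m).mul_left_cancel h).symm⟩

/-- Restates the valuation as two integrality conditions, which can be translated into absence of
poles and do not involve coefficients. -/
theorem order_eq_neg_one_iff {L : LaurentSeries B} : L.order = -1 ↔
    L ∉ (ofPS (B := B)).range ∧ ofPS PowerSeries.X * L ∈ (ofPS (B := B)).range := by
  constructor
  · intro h
    have hL0 : L ≠ 0 := by rintro rfl; simp at h
    refine ⟨?_, ?_⟩
    · rintro ⟨p, rfl⟩
      have := mt HahnSeries.coeff_order_eq_zero.1 hL0
      rw [h] at this
      exact this (coeff_ofPS_neg p (by norm_num))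
    · have hL := LaurentSeries.single_order_mul_powerSeriesPart L
      refine ⟨L.powerSeriesPart, ?_⟩
      conv_rhs => rw [← hL]
      rw [h, ofPS, HahnSeries.ofPowerSeries_X, ← mul_assoc, HahnSeries.single_mul_single]
      simp
  · rintro ⟨h1, p, hp⟩
    have hcoeff : ∀ i, L.coeff i = (ofPS p).coeff (i + 1) := fun i => by
      have := coeff_ofPS_X_pow_mul 1 L (i + 1)
      rw [pow_one, ← hp] at this
      rw [this]; simp
    have hL1 : L.coeff (-1) ≠ 0 := by
      intro h0
      rw [hcoeff, neg_add_cancel, ← Nat.cast_zero, coeff_ofPS_nat] at h0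
      refine h1 ((mem_range_ofPS_iff (m := 1) (by rw [pow_one]; exact hp.symm)).2 ?_)
      rw [pow_one]
      exact PowerSeries.X_dvd_iff.2 (by simpa using h0)
    refine le_antisymm (HahnSeries.order_le_of_coeff_ne_zero hL1) ?_
    by_contra! hlt
    have hL0 : L ≠ 0 := by rintro rfl; simp at hL1
    exact mt HahnSeries.coeff_order_eq_zero.1 hL0
      ((hcoeff _).trans (coeff_ofPS_neg p (by omega)))

end Laurent

/-! ### Taylor expansions of central elements -/

section Central

variable {K : Type u} [Field K] {θ : RingAut K}

theorem toQuot_algebraMap_of_mem_span (N : (FixedField θ)[X]) (a : (FixedField θ)[X])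
    (ha : a ∈ Ideal.span {N}) : ((toQuot θ N).comp (algebraMap _ _)) a = 0 := by
  obtain ⟨b, rfl⟩ := Ideal.mem_span_singleton'.1 ha
  rw [RingHom.comp_apply, map_mul, map_mul, toQuot_self, mul_zero]

variable (θ) in
/-- The embedding `F[Y]/N → 𝒜/N𝒜`. -/
def centralEmb (N : (FixedField θ)[X]) : AdjoinRoot N →+* Quot θ N :=
  Ideal.Quotient.lift (Ideal.span {N}) ((toQuot θ N).comp (algebraMap _ _))
    (toQuot_algebraMap_of_mem_span N)

theorem centralEmb_mk (N P : (FixedField θ)[X]) :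
    centralEmb θ N (AdjoinRoot.mk N P) = toQuot θ N (algebraMap _ _ P) := rfl

theorem centralEmb_commute (N : (FixedField θ)[X]) (c : AdjoinRoot N) (b : Quot θ N) :
    Commute (centralEmb θ N c) b := by
  obtain ⟨P, rfl⟩ := AdjoinRoot.mk_surjective c
  obtain ⟨a, rfl⟩ := Ideal.Quotient.mk_surjective b
  rw [centralEmb_mk]
  exact (SkewLaurent.commute_algebraMap P a).map (toQuot θ N)

/-- The Taylor expansion `P ↦ P(z + T)` at the class `z` of the variable in `F[Y]/N`. -/
def polyTaylor {F : Type*} [Field F] (N : F[X]) : F[X] →+* PowerSeries (AdjoinRoot N) :=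
  Polynomial.eval₂RingHom (PowerSeries.C.comp (AdjoinRoot.of N))
    (PowerSeries.C (AdjoinRoot.root N) + PowerSeries.X)

section PolyTaylor

variable {F : Type*} [Field F] (N : F[X])

theorem polyTaylor_C (a : F) :
    polyTaylor N (Polynomial.C a) = PowerSeries.C (AdjoinRoot.of N a) := by simp [polyTaylor]

theorem polyTaylor_X :
    polyTaylor N Polynomial.X = PowerSeries.C (AdjoinRoot.root N) + PowerSeries.X := by
  simp [polyTaylor]

theorem constantCoeff_polyTaylor (P : F[X]) :
    PowerSeries.constantCoeff (polyTaylor N P) = AdjoinRoot.mk N P := by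
  have : (PowerSeries.constantCoeff).comp (polyTaylor N) = AdjoinRoot.mk N := by
    apply Polynomial.ringHom_ext
    · intro a; simp [polyTaylor_C]
    · simp [polyTaylor_X]
  exact DFunLike.congr_fun this P

theorem derivative_polyTaylor (P : F[X]) :
    PowerSeries.derivative _ (polyTaylor N P) = polyTaylor N (derivative P) := by
  induction P using Polynomial.induction_on' with
  | add P Q hP hQ => simp only [map_add, hP, hQ]
  | monomial n a =>
    rw [← Polynomial.C_mul_X_pow_eq_monomial, map_mul, map_pow, polyTaylor_C, polyTaylor_X,
      Derivation.leibniz, PowerSeries.derivative_pow, Polynomial.derivative_C_mul_X_pow]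
    simp [polyTaylor_C, polyTaylor_X]
    ring

theorem isUnit_polyTaylor [Fact (Irreducible N)] {P : F[X]} (h : ¬ N ∣ P) :
    IsUnit (polyTaylor N P) := by
  rw [PowerSeries.isUnit_iff_constantCoeff, constantCoeff_polyTaylor]
  exact IsUnit.mk0 _ (mt AdjoinRoot.mk_eq_zero.1 h)

/-- $N(z+T)$ vanishes at $T=0$ with derivative $N'(z)$, nonzero by separability. This lets $N$ serve
as a uniformizer in place of $T$. -/
theorem polyTaylor_self (hN : N.Separable) :
    ∃ U V, polyTaylor N N = PowerSeries.X * U ∧ U * V = 1 := by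
  obtain ⟨U, hU⟩ := PowerSeries.X_dvd_iff.2
    ((constantCoeff_polyTaylor N N).trans AdjoinRoot.mk_self)
  have h1 := derivative_polyTaylor N N
  have h2 : PowerSeries.constantCoeff U = AdjoinRoot.mk N (derivative N) := by
    rw [← constantCoeff_polyTaylor, ← h1, hU, Derivation.leibniz, PowerSeries.derivative_X]
    simp
  have h3 : IsUnit U := by
    rw [PowerSeries.isUnit_iff_constantCoeff, h2]
    obtain ⟨a, b, hab⟩ := hN
    refine IsUnit.of_mul_eq_one_right (AdjoinRoot.mk N b) ?_
    have := congrArg (AdjoinRoot.mk N) hab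
    rwa [map_add, map_mul, map_mul, AdjoinRoot.mk_self, mul_zero, zero_add, map_one] at this
  obtain ⟨V, hV⟩ := h3.exists_right_inv
  exact ⟨U, V, hU, hV⟩

theorem polyTaylor_injective [Fact (Irreducible N)] : Function.Injective (polyTaylor N) := by
  refine (injective_iff_map_eq_zero _).2 fun P hP => ?_
  let Q := Polynomial.taylor (AdjoinRoot.root N) (P.map (AdjoinRoot.of N))
  have h1 : (polyTaylor N P) = (Q : PowerSeries (AdjoinRoot N)) := by
    have : polyTaylor N = Polynomial.coeToPowerSeries.ringHom.comp
        (((Polynomial.taylorAlgHom (AdjoinRoot.root N)).toRingHom).comp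
          (Polynomial.mapRingHom (AdjoinRoot.of N))) := by
      apply Polynomial.ringHom_ext
      · intro a; simp [polyTaylor_C]
      · simp [polyTaylor_X, add_comm]
    exact DFunLike.congr_fun this P
  rw [hP] at h1
  have h2 : Q = 0 := by simpa using h1.symm
  have h3 := Polynomial.taylor_injective (AdjoinRoot.root N) (h2.trans (map_zero _).symm)
  exact (Polynomial.map_eq_zero _).1 h3

end PolyTaylor

end Central

/-! ### Admissible morphisms -/

namespace Admissible

open SkewLaurent

variable {K : Type u} [Field K] {θ : RingAut K} {Fs : Type v} [Field Fs]
  [Algebra (FixedField θ) Fs] {z : Fs} (τ : Admissible θ z)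

/-- The restriction of `τ` to `𝒜`, with values in `(𝒜/N𝒜)[[T]]`. -/
def toPS : SkewLaurent θ →+* PowerSeries (Quot θ (minpoly (FixedField θ) z)) :=
  τ.toRingHom.comp (toCompletion θ _)

theorem onLaurent_apply (a : SkewLaurent θ) : τ.onLaurent a = ofPS (τ.toPS a) := rfl

theorem toPS_const (a : K) : τ.toPS (const θ a) = PowerSeries.C (toQuot θ _ (const θ a)) :=
  τ.map_const a

theorem constantCoeff_toPS (a : SkewLaurent θ) :
    PowerSeries.constantCoeff (τ.toPS a) = toQuot θ _ a := by
  have : (PowerSeries.constantCoeff).comp τ.toPS = toQuot θ _ := by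
    refine ringHom_ext (fun a => ?_) τ.map_X
    rw [RingHom.comp_apply, toPS_const, PowerSeries.constantCoeff_C]
  exact DFunLike.congr_fun this a

/-- On $F[Y]$ an admissible morphism is forced to be $P\mapsto P(z+T)$; the choice of $\tau$ affects
only $X$. -/
theorem toPS_algebraMap (P : (FixedField θ)[X]) : τ.toPS (algebraMap _ _ P) =
    PowerSeries.map (centralEmb θ _) (polyTaylor (minpoly (FixedField θ) z) P) := by
  have : τ.toPS.comp (algebraMap (FixedField θ)[X] _) =
      (PowerSeries.map (centralEmb θ _)).comp (polyTaylor (minpoly (FixedField θ) z)) := by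
    apply Polynomial.ringHom_ext
    · intro a
      rw [RingHom.comp_apply, algebraMap_C, toPS_const, RingHom.comp_apply, polyTaylor_C,
        PowerSeries.map_C, ← AdjoinRoot.mk_C, centralEmb_mk, algebraMap_C]
    · rw [RingHom.comp_apply, algebraMap_X, RingHom.comp_apply, polyTaylor_X, map_add,
        PowerSeries.map_C, ← AdjoinRoot.mk_X, centralEmb_mk, algebraMap_X, PowerSeries.map_X]
      exact τ.map_Y
  exact DFunLike.congr_fun this P

variable [IsSepClosure (FixedField θ) Fs]

/-- Expansions of polynomials in $Y$ have coefficients in the image of $F[Y]/N$, which is central,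
and this passes to quotients. It is what makes the Taylor expansion multiplicative. -/
theorem onCentral_commute (u : RatFunc (FixedField θ))
    (L : LaurentSeries (Quot θ (minpoly (FixedField θ) z))) : Commute (τ.onCentral u) L := by
  have h : ∀ P, Commute (τ.onCentral (algebraMap _ _ P)) L := fun P => by
    rw [onCentral_algebraMap, onLaurent_apply, toPS_algebraMap]
    exact commute_ofPS_of_commute (commute_map_powerSeries (centralEmb_commute _) _) L
  have h1 : IsUnit (τ.onCentral (algebraMap _ _ u.denom)) :=
    (IsUnit.mk0 _ (RatFunc.algebraMap_ne_zero u.denom_ne_zero)).map _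
  refine h1.mul_left_cancel ?_
  have hu := RatFunc.num_div_denom u
  rw [div_eq_iff (RatFunc.algebraMap_ne_zero u.denom_ne_zero)] at hu
  rw [← mul_assoc, ← map_mul, mul_comm _ u, ← hu, (h u.num).eq, ← mul_assoc, (h u.denom).eq,
    mul_assoc, ← map_mul, mul_comm _ u, ← hu]

/-- The Taylor expansion as a ring homomorphism. -/
def taylorHom : SkewFrac θ →+* LaurentSeries (Quot θ (minpoly (FixedField θ) z)) where
  __ := τ.taylor
  map_one' := by
    change τ.taylor (1 ⊗ₜ 1) = 1
    rw [taylor_tmul, map_one, map_one, one_mul]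
  map_mul' f g := by
    change τ.taylor (f * g) = τ.taylor f * τ.taylor g
    induction f using TensorProduct.induction_on with
    | zero => simp
    | add f f' hf hf' => rw [add_mul, map_add, map_add, hf, hf', add_mul]
    | tmul u a =>
      induction g using TensorProduct.induction_on with
      | zero => simp
      | add f f' hf hf' => rw [mul_add, map_add, map_add, hf, hf', mul_add]
      | tmul v b =>
        rw [Algebra.TensorProduct.tmul_mul_tmul, taylor_tmul, taylor_tmul, taylor_tmul, map_mul,
          map_mul, mul_assoc, mul_assoc, ← mul_assoc _ (τ.onLaurent a),
          (onCentral_commute τ v _).eq, mul_assoc]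

theorem taylorHom_apply (f : SkewFrac θ) : τ.taylorHom f = τ.taylor f := rfl

theorem taylorHom_ofLaurent (a : SkewLaurent θ) : τ.taylorHom (ofLaurent θ a) = ofPS (τ.toPS a) := by
  change τ.taylor (1 ⊗ₜ a) = _
  rw [taylor_tmul, map_one, one_mul, onLaurent_apply]

theorem taylorHom_ofCentral (u : RatFunc (FixedField θ)) :
    τ.taylorHom (ofCentral θ u) = τ.onCentral u := by
  change τ.taylor (u ⊗ₜ 1) = _
  rw [taylor_tmul, map_one, mul_one]

end Admissible

end SkewRes

namespace SkewRes

universe u v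

open SkewLaurent

/-! ### Poles and values in terms of Taylor expansions -/

namespace Admissible

variable {K : Type u} [Field K] {θ : RingAut K} {Fs : Type v} [Field Fs]
  [Algebra (FixedField θ) Fs] [IsSepClosure (FixedField θ) Fs] {z : Fs}

theorem irreducible_minpoly (z : Fs) : Irreducible (minpoly (FixedField θ) z) :=
  have : Algebra.IsSeparable (FixedField θ) Fs := IsSepClosure.separable
  minpoly.irreducible (Algebra.IsIntegral.isIntegral z)

theorem separable_minpoly (z : Fs) : (minpoly (FixedField θ) z).Separable :=
  have : Algebra.IsSeparable (FixedField θ) Fs := IsSepClosure.separable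
  Algebra.IsSeparable.isSeparable (FixedField θ) z

instance (z : Fs) : Fact (Irreducible (minpoly (FixedField θ) z)) := ⟨irreducible_minpoly z⟩

theorem exists_inv_polyTaylor {D : (FixedField θ)[X]} (hD : aeval z D ≠ 0) :
    ∃ V, polyTaylor (minpoly (FixedField θ) z) D * V = 1 :=
  (isUnit_polyTaylor _ (mt (minpoly.dvd_iff).1 hD)).exists_right_inv

theorem exists_inv_map_polyTaylor {D : (FixedField θ)[X]} (hD : aeval z D ≠ 0) :
    ∃ V, V * PowerSeries.map (centralEmb θ _) (polyTaylor (minpoly (FixedField θ) z) D) = 1 := by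
  obtain ⟨V, hV⟩ := exists_inv_polyTaylor hD
  exact ⟨PowerSeries.map (centralEmb θ _) V, by rw [← map_mul, mul_comm, hV, map_one]⟩

variable (τ : Admissible θ z)

theorem mul_taylorHom_eq {f : SkewFrac θ} {D : (FixedField θ)[X]} {g : SkewLaurent θ}
    (h : ofLaurent θ (algebraMap _ _ D) * f = ofLaurent θ g) :
    ofPS (PowerSeries.map (centralEmb θ _) (polyTaylor (minpoly (FixedField θ) z) D)) *
      τ.taylorHom f = ofPS (τ.toPS g) := by
  rw [← toPS_algebraMap, ← taylorHom_ofLaurent, ← taylorHom_ofLaurent, ← map_mul, h]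

/-- If the expansion of $f$ is integral, the expansion of $N^{n+1}Df=g$ has zero constant term. So
$g\in N\mathcal A$, and one factor $N$ can be removed from the denominator. -/
theorem hasNoPole_of_mem_range_aux {f : SkewFrac θ}
    (hf : τ.taylorHom f ∈ ofPS.range) (n : ℕ) (D : (FixedField θ)[X])
    (g : SkewLaurent θ) (hD : aeval z D ≠ 0)
    (h : ofLaurent θ (algebraMap _ _ (minpoly (FixedField θ) z ^ n * D)) * f = ofLaurent θ g) :
    HasNoPole z f := by
  induction n generalizing g with
  | zero => exact ⟨D, g, hD, by simpa using h⟩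
  | succ n ih =>
    obtain ⟨p, hp⟩ := hf
    have h1 := mul_taylorHom_eq τ h
    rw [← hp, ← map_mul] at h1
    have h2 := congrArg PowerSeries.constantCoeff (ofPS_injective h1)
    rw [constantCoeff_toPS, map_mul, ← PowerSeries.coeff_zero_eq_constantCoeff_apply,
      PowerSeries.coeff_map, PowerSeries.coeff_zero_eq_constantCoeff_apply,
      constantCoeff_polyTaylor, pow_succ', mul_assoc, map_mul (AdjoinRoot.mk _), AdjoinRoot.mk_self,
      zero_mul, map_zero, zero_mul] at h2
    obtain ⟨b, rfl⟩ := toQuot_eq_zero_iff.1 h2.symm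
    refine ih b ((isUnit_ofLaurent_algebraMap (irreducible_minpoly (θ := θ) z).ne_zero).mul_left_cancel ?_)
    rw [← map_mul, ← h, ← mul_assoc, ← map_mul, ← map_mul, pow_succ', mul_assoc]

/-- `f` has no pole at `z` if and only if its Taylor expansion is a power series. -/
theorem mem_range_iff_hasNoPole {f : SkewFrac θ} :
    τ.taylorHom f ∈ ofPS.range ↔ HasNoPole z f := by
  constructor
  · intro hf
    obtain ⟨D, g, hD, h⟩ := exists_denominator f
    obtain ⟨n, D', hD', rfl⟩ := WfDvdMonoid.max_power_factor hD (irreducible_minpoly (θ := θ) z)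
    exact hasNoPole_of_mem_range_aux τ hf n D' g (mt (minpoly.dvd_iff).2 hD') h
  · rintro ⟨D, g, hD, h⟩
    obtain ⟨V, hV⟩ := exists_inv_map_polyTaylor hD
    refine ⟨V * τ.toPS g, ?_⟩
    rw [map_mul, ← mul_taylorHom_eq τ h, ← mul_assoc, ← map_mul, hV, map_one, one_mul]

/-- The value at `z` is the constant coefficient of the Taylor expansion. -/
theorem hasValue_of_taylorHom_eq {f : SkewFrac θ} (hf : HasNoPole z f)
    {p : PowerSeries (Quot θ (minpoly (FixedField θ) z))} (hp : τ.taylorHom f = ofPS p) :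
    HasValue z f (PowerSeries.constantCoeff p) := by
  obtain ⟨D, g, hD, h⟩ := hf
  refine ⟨D, g, hD, h, ?_⟩
  have h1 := mul_taylorHom_eq τ h
  rw [hp, ← toPS_algebraMap τ, ← map_mul] at h1
  have h2 := congrArg PowerSeries.constantCoeff (ofPS_injective h1)
  rwa [map_mul, constantCoeff_toPS, constantCoeff_toPS] at h2

/-- Both constant terms solve $D(z)\,x=g$ in $\mathcal A/N\mathcal A$, where $D(z)$ is invertible.
-/
theorem constantCoeff_eq_of_taylorHom_eq (τ' : Admissible θ z) {f : SkewFrac θ} (hf : HasNoPole z f)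
    {p p' : PowerSeries (Quot θ (minpoly (FixedField θ) z))} (hp : τ.taylorHom f = ofPS p)
    (hp' : τ'.taylorHom f = ofPS p') :
    PowerSeries.constantCoeff p = PowerSeries.constantCoeff p' := by
  obtain ⟨D, g, hD, h⟩ := hf
  obtain ⟨V, hV⟩ := exists_inv_map_polyTaylor hD
  have h1 := mul_taylorHom_eq τ h
  have h1' := mul_taylorHom_eq τ' h
  rw [hp, ← map_mul] at h1
  rw [hp', ← map_mul] at h1'
  have h2 := congrArg PowerSeries.constantCoeff (ofPS_injective h1)
  have h2' := congrArg PowerSeries.constantCoeff (ofPS_injective h1')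
  have hV' := congrArg PowerSeries.constantCoeff hV
  rw [constantCoeff_toPS, map_mul] at h2 h2'
  rw [map_mul, map_one] at hV'
  have h3 := congrArg (PowerSeries.constantCoeff V * ·) (h2.trans h2'.symm)
  simpa only [← mul_assoc, hV', one_mul] using h3

/-- $N(z+T)$ is $T$ times a unit, so multiplying by $T$ can be replaced by multiplying by $N$, an
operation in $\mathrm{Frac}(\mathcal A)$ that does not see $\tau$. -/
theorem X_mul_taylorHom_mem_range_iff {f : SkewFrac θ} :
    ofPS PowerSeries.X * τ.taylorHom f ∈ ofPS.range ↔
      HasNoPole z (ofLaurent θ (algebraMap _ _ (minpoly (FixedField θ) z)) * f) := by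
  obtain ⟨U, V, hU, hUV⟩ := polyTaylor_self _ (separable_minpoly (θ := θ) z)
  rw [← mem_range_iff_hasNoPole τ, map_mul, taylorHom_ofLaurent, toPS_algebraMap, hU,
    mul_comm PowerSeries.X, map_mul, PowerSeries.map_X, map_mul, mul_assoc]
  constructor
  · exact fun h => mul_mem ⟨_, rfl⟩ h
  · intro h
    have h1 := mul_mem (⟨PowerSeries.map (centralEmb θ _) V, rfl⟩ :
      ofPS (PowerSeries.map (centralEmb θ _) V) ∈ ofPS.range) h
    rwa [← mul_assoc, ← map_mul, ← map_mul, mul_comm V, hUV, map_one, map_one, one_mul] at h1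

theorem order_taylor_eq_iff {f : SkewFrac θ} :
    (τ.taylor f).order = -1 ↔ ¬ HasNoPole z f ∧
      HasNoPole z (ofLaurent θ (algebraMap _ _ (minpoly (FixedField θ) z)) * f) := by
  rw [← taylorHom_apply, order_eq_neg_one_iff, mem_range_iff_hasNoPole τ,
    X_mul_taylorHom_mem_range_iff τ]

theorem hasSimplePole_iff {f : SkewFrac θ} :
    HasSimplePole θ z f ↔ (τ.taylor f).order = -1 := by
  refine ⟨fun ⟨τ', h⟩ => ?_, fun h => ⟨τ, h⟩⟩
  rw [order_taylor_eq_iff τ]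
  exact (order_taylor_eq_iff τ').1 h

theorem sres_eq_coeff {f : SkewFrac θ} {m : ℕ}
    {p : PowerSeries (Quot θ (minpoly (FixedField θ) z))}
    (h : ofPS PowerSeries.X ^ (m + 1) * τ.taylorHom f = ofPS p) :
    τ.sres f = PowerSeries.coeff m p := by
  rw [← coeff_ofPS_nat, ← h, coeff_ofPS_X_pow_mul]
  simp [sres, taylorHom_apply]

/-- The residue at a pole which is at most simple does not depend on the admissible morphism. -/
theorem sres_eq_sres (τ' : Admissible θ z) {f : SkewFrac θ}
    (hf : ofPS PowerSeries.X * τ.taylorHom f ∈ ofPS.range) : τ.sres f = τ'.sres f := by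
  have hN := (X_mul_taylorHom_mem_range_iff τ).1 hf
  have hf' := (X_mul_taylorHom_mem_range_iff τ').2 hN
  obtain ⟨p, hp⟩ := hf
  obtain ⟨p', hp'⟩ := hf'
  obtain ⟨U, V, hU, hUV⟩ := polyTaylor_self _ (separable_minpoly (θ := θ) z)
  -- The residue is the constant term of $T$ times the expansion of $f$; it differs from the value
  -- of $Nf$ by the factor $U(0)$, and neither that value nor $U$ depends on the morphism.
  have key : ∀ (τ : Admissible θ z) p, ofPS p = ofPS PowerSeries.X * τ.taylorHom f →
      τ.taylorHom (ofLaurent θ (algebraMap _ _ (minpoly (FixedField θ) z)) * f) =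
        ofPS (PowerSeries.map (centralEmb θ _) U * p) := fun τ p hp => by
    rw [map_mul, taylorHom_ofLaurent, toPS_algebraMap, hU,
      mul_comm PowerSeries.X, map_mul, PowerSeries.map_X, map_mul, mul_assoc, ← hp, map_mul]
  have h1 := constantCoeff_eq_of_taylorHom_eq τ τ' hN (key τ p hp) (key τ' p' hp')
  rw [map_mul, map_mul] at h1
  have h2 := congrArg (PowerSeries.constantCoeff ∘ PowerSeries.map (centralEmb θ _)) hUV
  rw [mul_comm] at h2
  simp only [Function.comp_apply, map_mul, map_one] at h2
  have h3 := congrArg (PowerSeries.constantCoeff (PowerSeries.map (centralEmb θ _) V) * ·) h1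
  simp only [← mul_assoc, h2, one_mul] at h3
  rw [sres_eq_coeff τ (m := 0) (by rw [zero_add, pow_one, hp]),
    sres_eq_coeff τ' (m := 0) (by rw [zero_add, pow_one, hp'])]
  simpa using h3

end Admissible

/-! ### Existence of admissible morphisms -/

section Existence

variable {K : Type u} [Field K] {θ : RingAut K} {Fs : Type v} [Field Fs]
  [Algebra (FixedField θ) Fs]

/-- An admissible morphism is determined by the image of `X`. -/
theorem exists_admissible_of_X {z : Fs} (x : PowerSeries (Quot θ (minpoly (FixedField θ) z)))
    (hx : ∀ a, x * PowerSeries.C (toQuot θ _ (const θ a)) =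
      PowerSeries.C (toQuot θ _ (const θ (θ a))) * x)
    (hx0 : PowerSeries.constantCoeff x = toQuot θ _ (X θ))
    (hxr : x ^ orderOf θ = PowerSeries.C (toQuot θ _ (Y θ)) + PowerSeries.X) :
    ∃ τ : Admissible θ z, τ.toPS (X θ) = x := by
  have hu : IsUnit x := by
    rw [PowerSeries.isUnit_iff_constantCoeff, hx0]
    exact (XUnit θ).isUnit.map (toQuot θ (minpoly (FixedField θ) z))
  let σ : SkewLaurent θ →+* PowerSeries (Quot θ (minpoly (FixedField θ) z)) :=
    lift θ (PowerSeries.C.comp ((toQuot θ (minpoly (FixedField θ) z)).comp (const θ))) hu.unit hx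
  have hσc : ∀ a, σ (const θ a) = PowerSeries.C (toQuot θ (minpoly (FixedField θ) z) (const θ a)) := lift_const θ _ _ hx
  have hσX : σ (X θ) = x := lift_X θ _ hu.unit hx
  have hσ0 : ∀ a, PowerSeries.constantCoeff (σ a) = toQuot θ (minpoly (FixedField θ) z) a := fun a => by
    have : (PowerSeries.constantCoeff).comp σ = toQuot θ (minpoly (FixedField θ) z) := by
      refine ringHom_ext (fun a => ?_) ?_
      · rw [RingHom.comp_apply, hσc, PowerSeries.constantCoeff_C]
      · rw [RingHom.comp_apply, hσX, hx0]
    exact DFunLike.congr_fun this a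
  -- $N$ goes to a series without constant term, so $N^m\mathcal A$ goes into the multiples of $T^m$
  -- and the morphism extends to the completion.
  obtain ⟨t, ht⟩ := exists_extension (toCompletion θ (minpoly (FixedField θ) z))
    (fun m => RingHom.ker ((Pi.evalRingHom (fun m => Quot θ ((minpoly (FixedField θ) z) ^ m)) m).comp
      (Completion θ (minpoly (FixedField θ) z)).subtype))
    (fun m n hmn x hx => by
      rw [RingHom.mem_ker] at hx ⊢
      exact (x.2 m n hmn).symm.trans ((congrArg _ hx).trans (map_zero _)))
    (fun x m => by
      obtain ⟨a, ha⟩ := Ideal.Quotient.mk_surjective (x.1 m)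
      refine ⟨a, ?_⟩
      rw [RingHom.mem_ker, map_sub, sub_eq_zero]
      exact ha.symm) σ
    (fun a m ha => by
      obtain ⟨b, rfl⟩ := toQuot_eq_zero_iff.1 (show toQuot θ ((minpoly (FixedField θ) z) ^ m) a = 0 from ha)
      rw [map_mul, map_pow, map_pow]
      obtain ⟨c, hc⟩ := X_pow_dvd_pow (p := σ (algebraMap _ _ (minpoly (FixedField θ) z))) (by rw [hσ0, toQuot_self]) m
      exact ⟨c * σ b, by rw [hc, mul_assoc]⟩)
  refine ⟨⟨t, fun a => ?_, ?_, ?_⟩, ?_⟩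
  · rw [ht, hσc]
  · rw [ht, hσX, hx0]
  · rw [ht, Y, map_pow, hσX, hxr]; rfl
  · exact (ht _).trans hσX

/-- $\Phi$ is contracting for the $T$-adic topology; the fixed point is the limit of the iterates of
$0$. -/
theorem exists_fixedPoint_powerSeries {E : Type*} [Ring E] (Φ : PowerSeries E → PowerSeries E)
    (h : ∀ a b n, PowerSeries.X ^ n ∣ a - b → PowerSeries.X ^ (n + 1) ∣ Φ a - Φ b) :
    ∃ w, Φ w = w := by
  let s : ℕ → PowerSeries E := fun n => Φ^[n] 0
  have hs : ∀ n, s (n + 1) = Φ (s n) := fun n => Function.iterate_succ_apply' Φ n 0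
  have h1 : ∀ n, PowerSeries.X ^ n ∣ s (n + 1) - s n := fun n => by
    induction n with
    | zero => simp
    | succ n ih => rw [hs (n + 1), hs n]; exact h _ _ _ (by rw [← hs n]; exact ih)
  have h2 : ∀ n k, k < n → PowerSeries.coeff k (s n) = PowerSeries.coeff k (s (k + 1)) := by
    intro n k hk
    induction n, Nat.succ_le_of_lt hk using Nat.le_induction with
    | base => rfl
    | succ n hn ih =>
      rw [← ih (by omega), ← sub_eq_zero, ← map_sub]
      exact PowerSeries.X_pow_dvd_iff.1 (h1 n) k (by omega)
  let w : PowerSeries E := PowerSeries.mk fun k => PowerSeries.coeff k (s (k + 1))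
  have hw : ∀ n, PowerSeries.X ^ n ∣ w - s n := fun n => by
    rw [PowerSeries.X_pow_dvd_iff]
    intro k hk
    rw [map_sub, h2 n k hk, PowerSeries.coeff_mk, sub_self]
  refine ⟨w, ?_⟩
  ext k
  have h3 := PowerSeries.X_pow_dvd_iff.1 (h _ _ _ (hw k)) k k.lt_succ_self
  have h4 := PowerSeries.X_pow_dvd_iff.1 (hw (k + 1)) k k.lt_succ_self
  rw [← hs, map_sub, sub_eq_zero] at h3
  rw [map_sub, sub_eq_zero] at h4
  rw [h3, h4]

/-- Hensel's lemma for `p(u) = 1 + cT`, where `p = 1 + U + ⋯`. -/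
theorem exists_eval_eq_one_add {F E : Type*} [CommRing F] [CommRing E] (f : F →+* E) (p : F[X])
    (h0 : p.coeff 0 = 1) (h1 : p.coeff 1 = 1) (c : E) :
    ∃ u : PowerSeries E, PowerSeries.constantCoeff u = 0 ∧
      p.eval₂ (PowerSeries.C.comp f) u = 1 + PowerSeries.C c * PowerSeries.X := by
  obtain ⟨q, hq⟩ : Polynomial.X ^ 2 ∣ p - (1 + Polynomial.X) := by
    rw [Polynomial.X_pow_dvd_iff]
    intro d hd
    interval_cases d
    · simp [h0]
    · simp [h1, Polynomial.coeff_one]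
  let G : Polynomial (PowerSeries E) :=
    Polynomial.X ^ 2 * (q.map (PowerSeries.C.comp f)).comp
      (Polynomial.C PowerSeries.X * Polynomial.X)
  -- Writing $p=1+U+U^2q$ and $u=Tw$, the equation becomes $w=c-T\,w^2q(Tw)$, a contraction in $w$.
  obtain ⟨w, hw⟩ := exists_fixedPoint_powerSeries
    (fun w => PowerSeries.C c - PowerSeries.X * G.eval w) (fun a b n hab => by
      have h2 : PowerSeries.C c - PowerSeries.X * G.eval a -
          (PowerSeries.C c - PowerSeries.X * G.eval b) =
          - (PowerSeries.X * (G.eval a - G.eval b)) := by ring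
      rw [h2, dvd_neg, pow_succ']
      exact mul_dvd_mul_left _ (hab.trans (Polynomial.sub_dvd_eval_sub a b G)))
  refine ⟨PowerSeries.X * w, by simp, ?_⟩
  have hG : G.eval w = w ^ 2 * q.eval₂ (PowerSeries.C.comp f) (PowerSeries.X * w) := by
    simp [G, Polynomial.eval_comp, Polynomial.eval_map]
  rw [← sub_add_cancel p (1 + Polynomial.X), hq]
  simp only [Polynomial.eval₂_add, Polynomial.eval₂_mul, Polynomial.eval₂_pow, Polynomial.eval₂_X,
    Polynomial.eval₂_one]
  rw [hG] at hw
  linear_combination PowerSeries.X * (-hw)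

/-- The norm of `1 + αU`, as a polynomial in `U`. -/
theorem exists_norm_polynomial (α : K) :
    ∃ p : (FixedField θ)[X], p.map (FixedField θ).subtype =
        ∏ k ∈ Finset.range (orderOf θ), (1 + Polynomial.C ((θ ^ k) α) * Polynomial.X) ∧
      p.coeff 0 = 1 ∧
      ((p.coeff 1 : FixedField θ) : K) = ∑ k ∈ Finset.range (orderOf θ), (θ ^ k) α := by
  set P : K[X] := ∏ k ∈ Finset.range (orderOf θ), (1 + Polynomial.C ((θ ^ k) α) * Polynomial.X)
    with hP
  have hmap : P.map (θ : K →+* K) = P := by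
    rw [hP, Polynomial.map_prod]
    have h : ∀ k, (1 + Polynomial.C ((θ ^ k) α) * Polynomial.X : K[X]).map (θ : K →+* K) =
        1 + Polynomial.C ((θ ^ (k + 1)) α) * Polynomial.X := fun k => by
      rw [pow_succ']
      simp
    simp only [h]
    -- Applying $\theta$ shifts the index of the factors by one. As $\theta^r=1$, the product is
    -- unchanged once the extra factor, whose constant coefficient is $1$, is cancelled.
    have h1 := Finset.prod_range_succ
      (fun k => (1 + Polynomial.C ((θ ^ k) α) * Polynomial.X : K[X])) (orderOf θ)
    rw [Finset.prod_range_succ', pow_orderOf_eq_one, pow_zero] at h1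
    refine mul_right_cancel₀ (fun h0 => ?_) h1
    simpa using congrArg (fun q => Polynomial.coeff q 0) h0
  have hcoeff : ∀ i, P.coeff i ∈ FixedField θ := fun i => by
    have := congrArg (fun q => Polynomial.coeff q i) hmap
    simp only [Polynomial.coeff_map] at this
    exact this
  obtain ⟨p, hp⟩ : P ∈ Polynomial.lifts (FixedField θ).subtype :=
    (Polynomial.lifts_iff_coeff_lifts P).2 fun i => ⟨⟨_, hcoeff i⟩, rfl⟩
  have hn : ∀ n, (∏ k ∈ Finset.range n, (1 + Polynomial.C ((θ ^ k) α) * Polynomial.X : K[X])).coeff 0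
      = 1 ∧ (∏ k ∈ Finset.range n, (1 + Polynomial.C ((θ ^ k) α) * Polynomial.X : K[X])).coeff 1 =
        ∑ k ∈ Finset.range n, (θ ^ k) α := fun n => by
    induction n with
    | zero => simp [Polynomial.coeff_one]
    | succ n ih =>
      rw [Finset.prod_range_succ, Finset.sum_range_succ, mul_add, mul_one, ← mul_assoc]
      refine ⟨by rw [Polynomial.coeff_add, Polynomial.coeff_mul_X_zero, ih.1, add_zero], ?_⟩
      rw [Polynomial.coeff_add, Polynomial.coeff_mul_X, Polynomial.coeff_mul_C, ih.1, ih.2, one_mul]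
  have hp' : p.map (FixedField θ).subtype = P := hp
  refine ⟨p, hp', ?_, ?_⟩
  · apply (FixedField θ).subtype.injective
    rw [← Polynomial.coeff_map, hp', map_one]
    exact (hn _).1
  · change (FixedField θ).subtype (p.coeff 1) = _
    rw [← Polynomial.coeff_map, hp']
    exact (hn _).2

/-- Seek $X\mapsto(1+\alpha u)X$ with $\mathrm{Tr}\,\alpha=1$ and $u$ a central series without
constant term. Its $r$-th power is $p(u)Y$, where $p=\prod_k(1+\theta^k(\alpha)U)=1+U+\cdots$, so
the condition is $p(u)=1+z^{-1}T$. The linear coefficient being $\mathrm{Tr}\,\alpha$ rather than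
$r$, no assumption on the characteristic is needed. -/
theorem exists_admissible (hθ : IsOfFinOrder θ) [IsSepClosure (FixedField θ) Fs] {z : Fs}
    (hz : z ≠ 0) : Nonempty (Admissible θ z) := by
  set N := minpoly (FixedField θ) z with hN
  have : Fact (Irreducible N) := ⟨Admissible.irreducible_minpoly z⟩
  have hy : AdjoinRoot.root N ≠ 0 := by
    rw [← AdjoinRoot.mk_X, Ne, AdjoinRoot.mk_eq_zero, hN, minpoly.dvd_iff, aeval_X]
    exact hz
  obtain ⟨α, hα⟩ := exists_trace_eq_one θ hθ
  obtain ⟨p, hp, hp0, hp1⟩ := exists_norm_polynomial (θ := θ) α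
  obtain ⟨u, hu0, hu⟩ := exists_eval_eq_one_add (AdjoinRoot.of N) p hp0
    (Subtype.ext (hp1.trans hα)) (AdjoinRoot.root N)⁻¹
  let e := centralEmb θ N
  let u' := PowerSeries.map e u
  have hu' : ∀ q, Commute u' q := commute_map_powerSeries (centralEmb_commute N) u
  let κ : K →+* PowerSeries (Quot θ N) := PowerSeries.C.comp ((toQuot θ N).comp (const θ))
  let ev : K[X] →+* PowerSeries (Quot θ N) :=
    Polynomial.eval₂RingHom' κ u' fun a => (hu' _).symm
  let c : ℕ → PowerSeries (Quot θ N) := fun i => 1 + κ ((θ ^ i) α) * u'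
  let x₀ : PowerSeries (Quot θ N) := PowerSeries.C (toQuot θ N (X θ))
  have hx₀ : ∀ a, x₀ * κ a = κ (θ a) * x₀ := fun a => by
    change PowerSeries.C (toQuot θ N (X θ)) * PowerSeries.C (toQuot θ N (const θ a)) =
      PowerSeries.C (toQuot θ N (const θ (θ a))) * PowerSeries.C (toQuot θ N (X θ))
    rw [← map_mul, ← map_mul, X_mul_const, map_mul, map_mul]
  have hc : ∀ i, x₀ * c i = c (i + 1) * x₀ := fun i => by
    simp only [c, mul_add, add_mul, mul_one, one_mul]
    rw [← mul_assoc, hx₀, mul_assoc, ← (hu' x₀).eq, ← mul_assoc, pow_succ']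
    rfl
  have hev : ∀ n, ((List.range n).map c).prod =
      ev (∏ k ∈ Finset.range n, (1 + Polynomial.C ((θ ^ k) α) * Polynomial.X)) := fun n => by
    induction n with
    | zero => simp
    | succ n ih =>
      rw [List.range_succ, List.map_append, List.prod_append, Finset.prod_range_succ, map_mul, ih]
      congr 1
      simp [ev, c]
  have hevp : ∀ q : (FixedField θ)[X], ev (q.map (FixedField θ).subtype) =
      PowerSeries.map e (q.eval₂ (PowerSeries.C.comp (AdjoinRoot.of N)) u) := fun q => by
    have : ev.comp (Polynomial.mapRingHom (FixedField θ).subtype) = (PowerSeries.map e).comp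
        (Polynomial.eval₂RingHom (PowerSeries.C.comp (AdjoinRoot.of N)) u) := by
      apply Polynomial.ringHom_ext
      · intro a
        simp only [RingHom.comp_apply, Polynomial.coe_mapRingHom, Polynomial.map_C,
          Polynomial.coe_eval₂RingHom, Polynomial.eval₂_C, PowerSeries.map_C]
        rw [← AdjoinRoot.mk_C, centralEmb_mk, algebraMap_C]
        simp [ev, κ]
      · simp [ev, u']
    exact DFunLike.congr_fun this q
  have he : e (AdjoinRoot.root N) = toQuot θ N (Y θ) := by
    rw [← AdjoinRoot.mk_X, centralEmb_mk, algebraMap_X]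
  refine (exists_admissible_of_X (z := z) (c 0 * x₀) (fun a => ?_) ?_ ?_).nonempty
  · change c 0 * x₀ * κ a = κ (θ a) * (c 0 * x₀)
    have : Commute (κ (θ a)) (c 0) := by
      refine (Commute.one_right _).add_right (Commute.mul_right ?_ (hu' _).symm)
      rw [Commute, SemiconjBy, ← map_mul, ← map_mul, mul_comm]
    rw [mul_assoc, hx₀, ← mul_assoc, ← mul_assoc, this.eq]
  · have : PowerSeries.constantCoeff u' = 0 := by
      rw [← PowerSeries.coeff_zero_eq_constantCoeff_apply, PowerSeries.coeff_map,
        PowerSeries.coeff_zero_eq_constantCoeff_apply, hu0, map_zero]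
    simp [c, this, x₀]
    rfl
  -- Multiplication by $X$ permutes cyclically the factors $1+\theta^i(\alpha)u$, so the power is
  -- $p(u)\,z=(1+z^{-1}T)z=z+T$.
  · rw [mul_pow_eq_prod_mul_pow hc, hev, ← hp, hevp, hu]
    have : x₀ ^ orderOf θ = PowerSeries.C (e (AdjoinRoot.root N)) := by
      rw [he, Y, map_pow, map_pow]
    rw [this, ← he, ← PowerSeries.map_C, ← map_mul, ← PowerSeries.map_X e, ← map_add]
    congr 1
    rw [add_mul, one_mul, mul_right_comm, ← map_mul, inv_mul_cancel₀ hy, map_one, one_mul]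

end Existence

end SkewRes

namespace SkewRes

universe u v

/-! ### Taylor expansions and endomorphisms -/

open SkewLaurent

variable {K : Type u} [Field K] {θ : RingAut K} {Fs : Type v} [Field Fs]
  [Algebra (FixedField θ) Fs] [IsSepClosure (FixedField θ) Fs] {z : Fs}

open Admissible

theorem SkewLaurent.exists_lift {R : Type*} [Ring R] (k : K →+* R) {x : R} (hx : IsUnit x)
    (h : ∀ a, x * k a = k (θ a) * x) :
    ∃ Ψ : SkewLaurent θ →+* R, (∀ a, Ψ (const θ a) = k a) ∧ Ψ (X θ) = x :=
  ⟨lift θ k hx.unit h, lift_const θ k hx.unit h, lift_X θ k hx.unit h⟩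

/-! ### Taylor expansions of rational functions -/

theorem Admissible.onCentral_eq (τ : Admissible θ z) {u : RatFunc (FixedField θ)}
    {A B : (FixedField θ)[X]} {ξ : PowerSeries (AdjoinRoot (minpoly (FixedField θ) z))} (hB : B ≠ 0)
    (hu : u * algebraMap _ _ B = algebraMap _ _ A)
    (hξ : ξ * polyTaylor _ B = polyTaylor _ A) :
    τ.onCentral u = ofPS (PowerSeries.map (centralEmb θ _) ξ) := by
  have h1 : IsUnit (τ.onCentral (algebraMap _ _ B)) :=
    (IsUnit.mk0 _ (RatFunc.algebraMap_ne_zero hB)).map _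
  refine h1.mul_right_cancel ?_
  rw [← map_mul, hu, onCentral_algebraMap, onLaurent_apply, toPS_algebraMap, ← hξ,
    onCentral_algebraMap, onLaurent_apply, toPS_algebraMap, map_mul, map_mul]

theorem Admissible.onCentral_eq_onCentral (τ τ' : Admissible θ z) (u : RatFunc (FixedField θ)) :
    τ.onCentral u = τ'.onCentral u := by
  have h : ∀ P, τ.onCentral (algebraMap _ _ P) = τ'.onCentral (algebraMap _ _ P) := fun P => by
    rw [onCentral_algebraMap, onCentral_algebraMap, onLaurent_apply, onLaurent_apply,
      toPS_algebraMap, toPS_algebraMap]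
  have h1 : IsUnit (τ.onCentral (algebraMap _ _ u.denom)) :=
    (IsUnit.mk0 _ (RatFunc.algebraMap_ne_zero u.denom_ne_zero)).map _
  have hu := RatFunc.num_div_denom u
  rw [div_eq_iff (RatFunc.algebraMap_ne_zero u.denom_ne_zero)] at hu
  refine h1.mul_right_cancel ?_
  rw [← map_mul, ← hu, h, hu, map_mul, h u.denom]

/-- The expansion at `z` of a rational function without pole at `z`. -/
theorem exists_ratTaylor {u : RatFunc (FixedField θ)} (hu : aeval z u.denom ≠ 0) :
    ∃ ζ : PowerSeries (AdjoinRoot (minpoly (FixedField θ) z)),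
      ζ * polyTaylor _ u.denom = polyTaylor _ u.num ∧
      (∀ τ : Admissible θ z, τ.onCentral u = ofPS (PowerSeries.map (centralEmb θ _) ζ)) ∧
      (∀ τ : Admissible θ z, τ.onCentral (derivY u) =
        ofPS (PowerSeries.map (centralEmb θ _) (PowerSeries.derivative _ ζ))) ∧
      PowerSeries.derivative _ ζ * polyTaylor _ (derivY u).denom =
        polyTaylor _ (derivY u).num := by
  obtain ⟨V, hV⟩ := exists_inv_polyTaylor hu
  have hζ : polyTaylor (minpoly (FixedField θ) z) u.num * V * polyTaylor _ u.denom =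
      polyTaylor _ u.num := by linear_combination polyTaylor _ u.num * hV
  set ζ := polyTaylor (minpoly (FixedField θ) z) u.num * V
  have hd := congrArg (PowerSeries.derivative _) hζ
  rw [Derivation.leibniz, smul_eq_mul, smul_eq_mul, derivative_polyTaylor,
    derivative_polyTaylor] at hd
  have hd2 : PowerSeries.derivative _ ζ * polyTaylor _ (u.denom ^ 2) =
      polyTaylor (minpoly (FixedField θ) z)
        (derivative u.num * u.denom - u.num * derivative u.denom) := by
    simp only [map_sub, map_mul, map_pow]
    linear_combination polyTaylor (minpoly (FixedField θ) z) u.denom * hd -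
      polyTaylor (minpoly (FixedField θ) z) (derivative u.denom) * hζ
  have hB : u.denom ^ 2 ≠ 0 := pow_ne_zero _ u.denom_ne_zero
  have hB' := RatFunc.algebraMap_ne_zero hB
  refine ⟨ζ, hζ, fun τ => τ.onCentral_eq u.denom_ne_zero ?_ hζ,
    fun τ => τ.onCentral_eq hB (div_mul_cancel₀ _ hB') hd2, ?_⟩
  · have hu := RatFunc.num_div_denom u
    rw [div_eq_iff (RatFunc.algebraMap_ne_zero u.denom_ne_zero)] at hu
    exact hu.symm
  -- The derivative is defined by a fraction that need not be reduced, whereas unramifiedness refers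
  -- to its reduced numerator; cross-multiplication links the two.
  · have h1 : (derivY u).num * u.denom ^ 2 =
        (derivative u.num * u.denom - u.num * derivative u.denom) * (derivY u).denom := by
      apply RatFunc.algebraMap_injective
      rw [map_mul, map_mul, ← div_eq_div_iff
        (RatFunc.algebraMap_ne_zero (derivY u).denom_ne_zero) hB', RatFunc.num_div_denom]
      rfl
    have h2 := congrArg (polyTaylor (minpoly (FixedField θ) z)) h1
    rw [map_mul, map_mul, ← hd2, map_pow] at h2
    linear_combination (-V ^ 2) * h2 + (polyTaylor (minpoly (FixedField θ) z) (derivY u).num -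
      PowerSeries.derivative _ ζ * polyTaylor _ (derivY u).denom) *
        (polyTaylor (minpoly (FixedField θ) z) u.denom * V + 1) * hV

variable (θ) in
/-- The embedding of `F[Y]/N` in `Fs` given by `z`. -/
def rootEmb (z : Fs) : AdjoinRoot (minpoly (FixedField θ) z) →+* Fs :=
  AdjoinRoot.lift (algebraMap _ _) z (minpoly.aeval _ z)

theorem rootEmb_mk (P : (FixedField θ)[X]) : rootEmb θ z (AdjoinRoot.mk _ P) = aeval z P :=
  AdjoinRoot.lift_mk _ _

/-! ### The change of variables attached to an endomorphism -/

section Endo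

variable {γ : SkewFrac θ →+* SkewFrac θ}

/-- The expansion `γ(Y)(z + T) = γ_⋆ z + T U(T)`. -/
theorem exists_imageY_expansion (hreg : IsRegularPoint γ z) (hunram : IsUnramifiedPoint γ z) :
    ∃ (y : AdjoinRoot (minpoly (FixedField θ) z))
      (U V : PowerSeries (AdjoinRoot (minpoly (FixedField θ) z))),
      rootEmb θ z y = pushPoint γ z ∧ U * V = 1 ∧
      (∀ τ : Admissible θ z, τ.onCentral (imageY γ) =
        ofPS (PowerSeries.map (centralEmb θ _) (PowerSeries.C y + PowerSeries.X * U))) ∧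
      (∀ τ : Admissible θ z, τ.onCentral (derivY (imageY γ)) =
        ofPS (PowerSeries.map (centralEmb θ _)
          (PowerSeries.derivative _ (PowerSeries.X * U)))) := by
  obtain ⟨ζ, h1, h2, h3, h4⟩ := exists_ratTaylor hreg.2
  obtain ⟨U, hU, hUc⟩ := exists_C_add_X_mul ζ
  have hd : PowerSeries.derivative _ ζ = PowerSeries.derivative _ (PowerSeries.X * U) := by
    conv_lhs => rw [hU, map_add, PowerSeries.derivative_C, zero_add]
  have h4' := congrArg (rootEmb θ z ∘ PowerSeries.constantCoeff) h4
  simp only [Function.comp_apply, map_mul, constantCoeff_polyTaylor, rootEmb_mk] at h4'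
  -- $U(0)$ is the value of $d\gamma(Y)/dY$ at $z$.
  have hU0 : PowerSeries.constantCoeff U ≠ 0 := by
    intro h0
    rw [hd, Derivation.leibniz, PowerSeries.derivative_X] at h4'
    simp only [smul_eq_mul, mul_one, map_add, map_mul, PowerSeries.constantCoeff_X, zero_mul,
      h0, add_zero, map_zero] at h4'
    exact hunram h4'.symm
  obtain ⟨V, hV⟩ := (PowerSeries.isUnit_iff_constantCoeff.2 (IsUnit.mk0 _ hU0)).exists_right_inv
  refine ⟨PowerSeries.coeff 0 ζ, U, V, ?_, hV, fun τ => by rw [← hU]; exact h2 τ,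
    fun τ => by rw [← hd]; exact h3 τ⟩
  have h1' := congrArg (rootEmb θ z ∘ PowerSeries.constantCoeff) h1
  simp only [Function.comp_apply, map_mul, constantCoeff_polyTaylor, rootEmb_mk] at h1'
  rw [PowerSeries.coeff_zero_eq_constantCoeff_apply, pushPoint, eq_div_iff hreg.2]
  exact h1'

theorem taylorHom_const (τ : Admissible θ z) (a : K) :
    τ.taylorHom (ofLaurent θ (const θ a)) = ofPS (PowerSeries.C (toQuot θ _ (const θ a))) := by
  rw [taylorHom_ofLaurent, toPS_const]

theorem taylorHom_imageY (hθ : IsOfFinOrder θ)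
    (hγ : ∀ a : K, γ (ofLaurent θ (const θ a)) = ofLaurent θ (const θ a)) (τ : Admissible θ z) :
    τ.taylorHom (γ (ofLaurent θ (Y θ))) = τ.onCentral (imageY γ) := by
  rw [← ofCentral_imageY γ hθ hγ, taylorHom_ofCentral]

/-- The expansion at `z` of `γ(a)`, for `a ∈ 𝒜`. -/
theorem exists_endoExpansion (hθ : IsOfFinOrder θ)
    (hγ : ∀ a : K, γ (ofLaurent θ (const θ a)) = ofLaurent θ (const θ a))
    (hpole : HasNoPole z (γ (ofLaurent θ (X θ)))) (τ : Admissible θ z)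
    {ζ : PowerSeries (AdjoinRoot (minpoly (FixedField θ) z))} (hζu : IsUnit ζ)
    (hζ : τ.onCentral (imageY γ) = ofPS (PowerSeries.map (centralEmb θ _) ζ)) :
    ∃ Ψ : SkewLaurent θ →+* PowerSeries (Quot θ (minpoly (FixedField θ) z)),
      ∀ a, τ.taylorHom (γ (ofLaurent θ a)) = ofPS (Ψ a) := by
  obtain ⟨w, hw⟩ := (mem_range_iff_hasNoPole τ).2 hpole
  have hwr : w ^ orderOf θ = PowerSeries.map (centralEmb θ _) ζ := by
    apply ofPS_injective
    rw [← hζ, ← taylorHom_imageY hθ hγ τ, map_pow, hw, Y, map_pow, map_pow, map_pow]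
  -- The image of $X$ is a unit because its $r$-th power is the expansion of $\gamma(Y)$, assumed
  -- invertible; the universal property of $\mathcal A$ then applies.
  have hwu : IsUnit w := (isUnit_pow_iff hθ.orderOf_pos.ne').1 (hwr ▸ hζu.map _)
  have hx : ∀ a, w * PowerSeries.C (toQuot θ _ (const θ a)) =
      PowerSeries.C (toQuot θ _ (const θ (θ a))) * w := fun a => by
    apply ofPS_injective
    rw [map_mul, map_mul, hw, ← taylorHom_const, ← taylorHom_const, ← map_mul, ← map_mul,
      endo_X_mul_const γ hγ]
  obtain ⟨Ψ, hΨc, hΨX⟩ := exists_lift (θ := θ)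
    (PowerSeries.C.comp ((toQuot θ (minpoly (FixedField θ) z)).comp (const θ))) hwu hx
  refine ⟨Ψ, fun a => ?_⟩
  have : τ.taylorHom.comp (γ.comp (ofLaurent θ)) = ofPS.comp Ψ := by
    refine ringHom_ext (fun a => ?_) ?_
    · simp only [RingHom.comp_apply]
      rw [hγ, taylorHom_const, hΨc]
      rfl
    · simp only [RingHom.comp_apply]
      rw [hΨX, hw]
  exact DFunLike.congr_fun this a

/-- The expansions of `γ(P)` for `P ∈ F[Y]`. -/
theorem endoExpansion_algebraMap (hθ : IsOfFinOrder θ)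
    (hγ : ∀ a : K, γ (ofLaurent θ (const θ a)) = ofLaurent θ (const θ a)) {τ : Admissible θ z}
    {ζ : PowerSeries (AdjoinRoot (minpoly (FixedField θ) z))}
    (hζ : τ.onCentral (imageY γ) = ofPS (PowerSeries.map (centralEmb θ _) ζ))
    {Ψ : SkewLaurent θ →+* PowerSeries (Quot θ (minpoly (FixedField θ) z))}
    (hΨ : ∀ a, τ.taylorHom (γ (ofLaurent θ a)) = ofPS (Ψ a)) (P : (FixedField θ)[X]) :
    Ψ (algebraMap _ _ P) = PowerSeries.map (centralEmb θ _)
      (P.eval₂ (PowerSeries.C.comp (AdjoinRoot.of _)) ζ) := by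
  have : Ψ.comp (algebraMap _ _) = (PowerSeries.map (centralEmb θ _)).comp
      (Polynomial.eval₂RingHom (PowerSeries.C.comp (AdjoinRoot.of _)) ζ) := by
    apply Polynomial.ringHom_ext
    · intro a
      apply ofPS_injective
      simp only [RingHom.comp_apply, Polynomial.coe_eval₂RingHom, Polynomial.eval₂_C,
        PowerSeries.map_C]
      rw [← AdjoinRoot.mk_C, centralEmb_mk, algebraMap_C, ← hΨ, hγ, taylorHom_const]
    · apply ofPS_injective
      simp only [RingHom.comp_apply, Polynomial.coe_eval₂RingHom, Polynomial.eval₂_X]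
      rw [algebraMap_X, ← hΨ, taylorHom_imageY hθ hγ, hζ]
  exact DFunLike.congr_fun this P

/-- Transport of admissible morphisms through an endomorphism. -/
theorem exists_admissible_transport (hθ : IsOfFinOrder θ)
    (hγ : ∀ a : K, γ (ofLaurent θ (const θ a)) = ofLaurent θ (const θ a)) (τ : Admissible θ z)
    {w : PowerSeries (Quot θ (minpoly (FixedField θ) z))} (hwu : IsUnit w)
    (hw : τ.taylorHom (γ (ofLaurent θ (X θ))) = ofPS w)
    {W : PowerSeries (Quot θ (minpoly (FixedField θ) z))}
    (hW : ∀ a, W * PowerSeries.C (toQuot θ _ (const θ a)) =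
      PowerSeries.C (toQuot θ _ (const θ (θ a))) * W)
    (hW0 : PowerSeries.constantCoeff W = PowerSeries.constantCoeff w)
    (hWr : W ^ orderOf θ = w ^ orderOf θ) :
    ∃ τ' : Admissible θ z, τ'.taylorHom (γ (ofLaurent θ (X θ))) = ofPS W := by
  obtain ⟨w, rfl⟩ := hwu
  have hwK : ∀ a, (w : PowerSeries (Quot θ (minpoly (FixedField θ) z))) *
      PowerSeries.C (toQuot θ (minpoly (FixedField θ) z) (const θ a)) =
        PowerSeries.C (toQuot θ (minpoly (FixedField θ) z) (const θ (θ a))) *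
          (w : PowerSeries (Quot θ (minpoly (FixedField θ) z))) :=
    fun a => by
      apply ofPS_injective
      rw [map_mul, map_mul, ← hw, ← taylorHom_const, ← taylorHom_const, ← map_mul, ← map_mul,
        endo_X_mul_const γ hγ]
  set x₀ := τ.toPS (X θ) with hx₀
  set v := (↑w⁻¹ : PowerSeries (Quot θ (minpoly (FixedField θ) z))) * W with hv
  have hwv : (w : PowerSeries (Quot θ (minpoly (FixedField θ) z))) * v = W := by
    rw [hv, ← mul_assoc, Units.mul_inv, one_mul]
  have hvK : ∀ a, Commute (PowerSeries.C (toQuot θ (minpoly (FixedField θ) z) (const θ a))) v :=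
    fun a => by
      refine w.isUnit.mul_left_cancel ?_
      rw [← mul_assoc, hwK, mul_assoc, hwv, ← mul_assoc, hwv, hW]
  have hc : ∀ i, ofPS x₀ * τ.taylorHom (twistConj γ i) =
      τ.taylorHom (twistConj γ (i + 1)) * ofPS x₀ := fun i => by
    rw [hx₀, ← taylorHom_ofLaurent, ← map_mul, X_mul_twistConj, map_mul]
  -- Each $X^icX^{-i}$ is generated by $K$ and $F(Y)$: $v$ commutes with $K$, and the expansions of
  -- $F(Y)$ are central.
  have hcv : ∀ i, Commute (τ.taylorHom (twistConj γ i)) (ofPS v) := fun i =>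
    commute_map_of_commute_const hθ τ.taylorHom (twistConj_commute_const γ hγ i)
      (fun a => by rw [taylorHom_const]; exact (hvK a).map ofPS)
      (fun u => by rw [taylorHom_ofCentral]; exact onCentral_commute τ u _)
  have hc' : ∀ i, ofPS x₀ * ofPS v * τ.taylorHom (twistConj γ i) =
      τ.taylorHom (twistConj γ (i + 1)) * (ofPS x₀ * ofPS v) := fun i => by
    rw [mul_assoc, ← (hcv i).eq, ← mul_assoc, hc, mul_assoc]
  have htw : τ.taylorHom (twistConj γ 0) * ofPS x₀ = ofPS (w : PowerSeries _) := by
    rw [twistConj_zero, hx₀, ← taylorHom_ofLaurent, ← map_mul, twist_mul_X, hw]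
  have hx₀u : IsUnit (ofPS x₀) := by
    rw [hx₀, ← taylorHom_ofLaurent]; exact isUnit_ofLaurent_X.map _
  -- With $c_i$ the image of $X^icX^{-i}$, both $w^r=\prod c_i\cdot x_0^r$ and
  -- $W^r=(c_0x_0v)^r=\prod c_i\cdot(x_0v)^r$ hold; the product is a unit, so $(x_0v)^r=x_0^r$.
  have h1 := mul_pow_eq_prod_mul_pow (c := fun i => τ.taylorHom (twistConj γ i)) hc (orderOf θ)
  have h2 := mul_pow_eq_prod_mul_pow (c := fun i => τ.taylorHom (twistConj γ i)) hc' (orderOf θ)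
  rw [htw] at h1
  rw [← mul_assoc, htw, ← map_mul, hwv, ← map_pow, hWr, map_pow, h1] at h2
  have hprod : IsUnit ((List.range (orderOf θ)).map fun i => τ.taylorHom (twistConj γ i)).prod := by
    have h3 : IsUnit (ofPS (w : PowerSeries (Quot θ (minpoly (FixedField θ) z))) ^ orderOf θ) :=
      (w.isUnit.map ofPS).pow _
    rw [h1] at h3
    obtain ⟨y, hy⟩ := hx₀u.pow (orderOf θ)
    rw [← hy] at h3
    exact (Units.isUnit_mul_units _ y).1 h3
  have h4 : (x₀ * v) ^ orderOf θ = x₀ ^ orderOf θ := by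
    apply ofPS_injective
    rw [map_pow, map_pow, map_mul]
    exact (hprod.mul_left_cancel h2).symm
  obtain ⟨τ', hτ'⟩ := exists_admissible_of_X (z := z) (x₀ * v) (fun a => by
      rw [mul_assoc, ← (hvK a).eq, ← mul_assoc, ← mul_assoc, hx₀, ← toPS_const, ← map_mul,
        X_mul_const, map_mul, toPS_const]
      simp only [hv, mul_assoc]) (by
      rw [map_mul, hv, map_mul, hW0, ← map_mul, Units.inv_mul, map_one, mul_one, hx₀,
        constantCoeff_toPS]) (by
      rw [h4, hx₀, ← map_pow]
      exact τ.map_Y)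
  refine ⟨τ', ?_⟩
  -- Changing $\tau(X)$ leaves the image of $c=\gamma(X)X^{-1}$ unchanged, so $\gamma(X)=cX$ now
  -- goes to $wv=W$.
  have htw' : τ'.taylorHom (twist γ) = τ.taylorHom (twist γ) :=
    map_eq_of_commute_const hθ (twist_commute_const γ hγ)
      (fun a => by rw [taylorHom_const, taylorHom_const])
      (fun u => by rw [taylorHom_ofCentral, taylorHom_ofCentral]; exact onCentral_eq_onCentral _ _ u)
  rw [twistConj_zero] at htw
  rw [← twist_mul_X, map_mul, htw', taylorHom_ofLaurent, hτ', map_mul, ← mul_assoc, htw, ← map_mul,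
    hwv]

end Endo

/-! ### Comparison of Taylor expansions through a change of variables -/

section Comparison

variable {z₁ z₂ : Fs} {γ : SkewFrac θ →+* SkewFrac θ} {τ₁ : Admissible θ z₁}
  {τ₂ : Admissible θ z₂}
  {g : Quot θ (minpoly (FixedField θ) z₁) →+* Quot θ (minpoly (FixedField θ) z₂)}
  {t : PowerSeries (Quot θ (minpoly (FixedField θ) z₁)) →+*
    PowerSeries (Quot θ (minpoly (FixedField θ) z₂))}
  {U V : PowerSeries (AdjoinRoot (minpoly (FixedField θ) z₂))}

/-- Expresses, with denominators cleared, that the expansion of $\gamma(f)$ is the image of that of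
$f$ under $t$ extended to Laurent series: $t(T)^{-1}=T^{-1}V$ accounts for the power of $V$. A
central denominator of $f$ expands as $T^n$ times a unit, which gives the exponent. -/
theorem exists_taylor_comparison
    (hτ : ∀ a, τ₂.taylorHom (γ (ofLaurent θ a)) = ofPS (t (τ₁.toPS a)))
    (hX : t PowerSeries.X = PowerSeries.map (centralEmb θ _) (PowerSeries.X * U))
    (hUV : U * V = 1) (f : SkewFrac θ) :
    ∃ (m : ℕ) (p : PowerSeries (Quot θ (minpoly (FixedField θ) z₁))),
      ofPS PowerSeries.X ^ (m + 1) * τ₁.taylorHom f = ofPS p ∧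
      ofPS PowerSeries.X ^ (m + 1) * τ₂.taylorHom (γ f) =
        ofPS (PowerSeries.map (centralEmb θ _) V ^ (m + 1) * t p) := by
  obtain ⟨D, a, hD, h⟩ := exists_denominator f
  have hne : polyTaylor (minpoly (FixedField θ) z₁) D ≠ 0 := fun h0 =>
    hD (polyTaylor_injective _ (h0.trans (map_zero _).symm))
  set n := (polyTaylor (minpoly (FixedField θ) z₁) D).order.toNat with hn
  obtain ⟨ε, δ, hε, hεδ⟩ : ∃ ε δ, polyTaylor (minpoly (FixedField θ) z₁) D =
      PowerSeries.X ^ n * ε ∧ δ * ε = 1 := by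
    obtain ⟨δ, hδ⟩ := (PowerSeries.isUnit_divided_by_X_pow_order hne).exists_left_inv
    exact ⟨_, δ, PowerSeries.X_pow_order_mul_divXPowOrder.symm, hδ⟩
  let e₁ := centralEmb θ (minpoly (FixedField θ) z₁)
  have h1 : ofPS PowerSeries.X ^ n * τ₁.taylorHom f =
      ofPS (PowerSeries.map e₁ δ * τ₁.toPS a) := by
    have h2 := mul_taylorHom_eq τ₁ h
    rw [map_mul, ← h2, hε, mul_comm _ ε, ← mul_assoc, ← map_mul, ← map_mul, ← mul_assoc, hεδ,
      one_mul, map_pow, map_pow, PowerSeries.map_X]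
  have h2 : ofPS (t PowerSeries.X) ^ n * τ₂.taylorHom (γ f) =
      ofPS (t (PowerSeries.map e₁ δ * τ₁.toPS a)) := by
    have h3 := congrArg (fun f => τ₂.taylorHom (γ f)) h
    simp only [map_mul] at h3
    rw [hτ, hτ, toPS_algebraMap, hε, mul_comm _ ε] at h3
    rw [map_mul, map_mul, ← h3, ← mul_assoc, ← map_mul, ← map_mul, ← map_mul, ← mul_assoc, hεδ,
      one_mul, map_pow, map_pow, map_pow, PowerSeries.map_X]
  -- The extra factor $T$ makes the exponent at least $1$, so that the residue sits at index $m$ of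
  -- $p$ even when $n=0$.
  refine ⟨n, PowerSeries.X * (PowerSeries.map e₁ δ * τ₁.toPS a), ?_, ?_⟩
  · rw [pow_succ', mul_assoc, h1, ← map_mul]
  · have h3 : ofPS (t PowerSeries.X) ^ (n + 1) * τ₂.taylorHom (γ f) =
        ofPS (t (PowerSeries.X * (PowerSeries.map e₁ δ * τ₁.toPS a))) := by
      rw [pow_succ', mul_assoc, h2, ← map_mul, ← map_mul]
    have h4 : V * (PowerSeries.X * U) = PowerSeries.X := by linear_combination PowerSeries.X * hUV
    have h5 : PowerSeries.map (centralEmb θ (minpoly (FixedField θ) z₂)) V ^ (n + 1) *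
        PowerSeries.map (centralEmb θ (minpoly (FixedField θ) z₂)) (PowerSeries.X * U) ^ (n + 1) =
          PowerSeries.X ^ (n + 1) := by
      rw [← map_pow, ← map_pow, ← map_mul, ← mul_pow, h4, map_pow, PowerSeries.map_X]
    have h6 := congrArg ofPS h5
    rw [map_mul ofPS, map_pow ofPS (PowerSeries.map _ (PowerSeries.X * U)),
      map_pow ofPS PowerSeries.X] at h6
    rw [map_mul, ← h3, hX, ← mul_assoc, h6]

/-- Residues are compatible with changes of variables. -/
theorem sres_change_of_variables {u : RatFunc (FixedField θ)}
    (hτ : ∀ a, τ₂.taylorHom (γ (ofLaurent θ a)) = ofPS (t (τ₁.toPS a)))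
    (hC : ∀ b, t (PowerSeries.C b) = PowerSeries.C (g b))
    (hX : t PowerSeries.X = PowerSeries.map (centralEmb θ _) (PowerSeries.X * U))
    (hUV : U * V = 1)
    (hu : τ₂.onCentral u = ofPS (PowerSeries.map (centralEmb θ _)
      (PowerSeries.derivative _ (PowerSeries.X * U)))) (f : SkewFrac θ) :
    g (τ₁.sres f) = τ₂.sres (γ f * ofCentral θ u) := by
  obtain ⟨m, p, h1, h2⟩ := exists_taylor_comparison hτ hX hUV f
  rw [sres_eq_coeff τ₁ h1, ← coeff_change_of_variables hC hX hUV m p]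
  refine (sres_eq_coeff τ₂ ?_).symm
  rw [← (ofCentral_commute u (γ f)).eq, map_mul, taylorHom_ofCentral, ← mul_assoc,
    ← (onCentral_commute τ₂ u _).eq, mul_assoc, h2, hu, ← map_mul, ← mul_assoc, ← map_pow,
    ← map_mul, mul_comm (V ^ (m + 1))]

/-- Injectivity of $g$ makes $t$ preserve divisibility by powers of $T$, and the power of $V$ is a
unit. -/
theorem order_taylor_change_of_variables (hg : Function.Injective g)
    (hτ : ∀ a, τ₂.taylorHom (γ (ofLaurent θ a)) = ofPS (t (τ₁.toPS a)))
    (hC : ∀ b, t (PowerSeries.C b) = PowerSeries.C (g b))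
    (hX : t PowerSeries.X = PowerSeries.map (centralEmb θ _) (PowerSeries.X * U))
    (hUV : U * V = 1) (f : SkewFrac θ) :
    (τ₁.taylor f).order = -1 ↔ (τ₂.taylor (γ f)).order = -1 := by
  obtain ⟨m, p, h1, h2⟩ := exists_taylor_comparison hτ hX hUV f
  have key : ∀ n, PowerSeries.X ^ n ∣ PowerSeries.map (centralEmb θ _) V ^ (m + 1) * t p ↔
      PowerSeries.X ^ n ∣ p := fun n => by
    rw [X_pow_dvd_unit_mul_iff ((mul_comm V U).trans hUV), X_pow_dvd_subst_iff hg hC hX hUV]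
  have h1' := h1
  have h2' := h2
  rw [pow_succ, mul_assoc] at h1' h2'
  rw [← taylorHom_apply, ← taylorHom_apply, order_eq_neg_one_iff, order_eq_neg_one_iff,
    mem_range_ofPS_iff h1, mem_range_ofPS_iff h1', mem_range_ofPS_iff h2, mem_range_ofPS_iff h2',
    key, key]

end Comparison

end SkewRes

/-! ### The induced morphism, its lift to expansions, and the conclusion -/

namespace SkewRes

universe u v

open SkewLaurent Admissible

variable {K : Type u} [Field K] {θ : RingAut K} {Fs : Type v} [Field Fs]
  [Algebra (FixedField θ) Fs] [IsSepClosure (FixedField θ) Fs] {z : Fs}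
  {γ : SkewFrac θ →+* SkewFrac θ}

/-- The morphism induced by `γ` on the residue rings, with the change of variables that it induces
on Taylor expansions. -/
theorem exists_induced_and_change_of_variables (hθ : IsOfFinOrder θ)
    (hγ : ∀ a : K, γ (ofLaurent θ (const θ a)) = ofLaurent θ (const θ a)) (hz : z ≠ 0)
    (hreg : IsRegularPoint γ z) (hpole : HasNoPole z (γ (ofLaurent θ (X θ))))
    {y : AdjoinRoot (minpoly (FixedField θ) z)}
    {U : PowerSeries (AdjoinRoot (minpoly (FixedField θ) z))}
    (hy : rootEmb θ z y = pushPoint γ z)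
    (hexp : ∀ τ : Admissible θ z, τ.onCentral (imageY γ) =
      ofPS (PowerSeries.map (centralEmb θ _) (PowerSeries.C y + PowerSeries.X * U))) :
    ∃ γbar : Quot θ (minpoly (FixedField θ) (pushPoint γ z)) →+*
        Quot θ (minpoly (FixedField θ) z),
      IsInducedBy γ z γbar ∧ ∀ τ₁ : Admissible θ (pushPoint γ z), ∃ (τ₂ : Admissible θ z)
        (t : PowerSeries (Quot θ (minpoly (FixedField θ) (pushPoint γ z))) →+*
          PowerSeries (Quot θ (minpoly (FixedField θ) z))),
        (∀ a, τ₂.taylorHom (γ (ofLaurent θ a)) = ofPS (t (τ₁.toPS a))) ∧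
        (∀ b, t (PowerSeries.C b) = PowerSeries.C (γbar b)) ∧
        t PowerSeries.X = PowerSeries.map (centralEmb θ _) (PowerSeries.X * U) := by
  obtain ⟨τ⟩ := exists_admissible hθ hz
  set ζ := PowerSeries.C y + PowerSeries.X * U with hζ
  have hζ0 : PowerSeries.constantCoeff ζ = y := by simp [hζ]
  have hy0 : y ≠ 0 := by
    rintro rfl
    rw [map_zero] at hy
    exact div_ne_zero hreg.1 hreg.2 hy.symm
  -- This uses that $\gamma(Y)$ has no zero at $z$, that is, $\gamma_\star z\ne0$.
  have hζu : IsUnit ζ := PowerSeries.isUnit_iff_constantCoeff.2 (hζ0 ▸ IsUnit.mk0 _ hy0)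
  obtain ⟨Ψ, hΨ⟩ := exists_endoExpansion hθ hγ hpole τ hζu (hexp τ)
  have hΨP := endoExpansion_algebraMap hθ hγ (hexp τ) hΨ
  have hΨY : Ψ (Y θ) = PowerSeries.map (centralEmb θ _) ζ := by
    rw [← algebraMap_X, hΨP, Polynomial.eval₂_X]
  have hΨc : ∀ a, Ψ (const θ a) = PowerSeries.C (toQuot θ _ (const θ a)) := fun a => by
    apply ofPS_injective
    rw [← hΨ, hγ, taylorHom_const]
  have hker : ∀ a ∈ centralIdeal θ (minpoly (FixedField θ) (pushPoint γ z)),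
      (PowerSeries.constantCoeff.comp Ψ) a = 0 := fun a ha => by
    obtain ⟨b, rfl⟩ := toQuot_eq_zero_iff.1 (Ideal.Quotient.eq_zero_iff_mem.2 ha)
    -- $N_1$ kills the constant term $y$ of the expansion of $\gamma(Y)$: this is tested in
    -- $F^{\mathrm s}$, where $y$ becomes $\gamma_\star z$. Hence the expansion of $\gamma$ modulo
    -- $T$ factors through $\mathcal A/N_1\mathcal A$, which defines $\bar\gamma$.
    have h1 : (minpoly (FixedField θ) (pushPoint γ z)).eval₂
        (AdjoinRoot.of (minpoly (FixedField θ) z)) y = 0 := by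
      apply (rootEmb θ z).injective
      rw [Polynomial.hom_eval₂, hy, map_zero]
      have h2 : (rootEmb θ z).comp (AdjoinRoot.of (minpoly (FixedField θ) z)) =
          algebraMap (FixedField θ) Fs := by
        ext c
        exact AdjoinRoot.lift_of (minpoly.aeval (FixedField θ) z)
      rw [h2]
      exact minpoly.aeval _ _
    have h3 : PowerSeries.constantCoeff ((minpoly (FixedField θ) (pushPoint γ z)).eval₂
        (PowerSeries.C.comp (AdjoinRoot.of (minpoly (FixedField θ) z))) ζ) = 0 := by
      rw [Polynomial.hom_eval₂, hζ0, ← h1]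
      rfl
    rw [RingHom.comp_apply, map_mul, map_mul, hΨP,
      ← PowerSeries.coeff_zero_eq_constantCoeff_apply, PowerSeries.coeff_map,
      PowerSeries.coeff_zero_eq_constantCoeff_apply, h3, map_zero, zero_mul]
  let γbar := Ideal.Quotient.lift (centralIdeal θ (minpoly (FixedField θ) (pushPoint γ z)))
    (PowerSeries.constantCoeff.comp Ψ) hker
  have hγbar : ∀ a, γbar (toQuot θ _ a) = PowerSeries.constantCoeff (Ψ a) := fun a => rfl
  refine ⟨γbar, fun a => ?_, fun τ₁ => ?_⟩
  · exact hasValue_of_taylorHom_eq τ ((mem_range_iff_hasNoPole τ).1 ⟨_, (hΨ a).symm⟩) (hΨ a)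
  have hφ : PowerSeries.constantCoeff (PowerSeries.map (centralEmb θ _) (PowerSeries.X * U)) = 0 := by
    rw [map_mul, PowerSeries.map_X, map_mul, PowerSeries.constantCoeff_X, zero_mul]
  obtain ⟨t, htC, htX⟩ := exists_substitution γbar
    (PowerSeries.map (centralEmb θ _) (PowerSeries.X * U))
    (fun q => (commute_map_powerSeries (centralEmb_commute _) _ q).symm) hφ
  have htc : ∀ a, t (τ₁.toPS (const θ a)) = PowerSeries.C (toQuot θ _ (const θ a)) := fun a => by
    rw [toPS_const, htC, hγbar, hΨc, PowerSeries.constantCoeff_C]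
  -- $t$ sends $\gamma_\star z+T$ to the expansion of $\gamma(Y)$, which supplies the equality of
  -- $r$-th powers needed for the transport.
  have htY : t (τ₁.toPS (Y θ)) = PowerSeries.map (centralEmb θ _) ζ := by
    have h1 : τ₁.toPS (Y θ) = PowerSeries.C (toQuot θ _ (Y θ)) + PowerSeries.X := τ₁.map_Y
    rw [h1, map_add, htC, htX, hγbar, hΨY, ← PowerSeries.coeff_zero_eq_constantCoeff_apply,
      PowerSeries.coeff_map, PowerSeries.coeff_zero_eq_constantCoeff_apply, hζ0, hζ, map_add,
      PowerSeries.map_C]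
  obtain ⟨τ₂, hτ₂⟩ := exists_admissible_transport hθ hγ τ
    (w := Ψ (X θ)) (W := t (τ₁.toPS (X θ))) ((XUnit θ).isUnit.map Ψ) (hΨ _)
    (fun a => by rw [← htc, ← htc, ← map_mul, ← map_mul, ← map_mul, ← map_mul, X_mul_const])
    (by
      obtain ⟨q, hq, -⟩ := exists_C_add_X_mul (τ₁.toPS (X θ))
      rw [hq, map_add, map_mul, htC, htX, map_add, map_mul, hφ, zero_mul, add_zero,
        PowerSeries.constantCoeff_C, PowerSeries.coeff_zero_eq_constantCoeff_apply,
        constantCoeff_toPS, hγbar])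
    (by rw [← map_pow, ← map_pow, ← map_pow]; exact htY.trans hΨY.symm)
  refine ⟨τ₂, t, fun a => ?_, htC, htX⟩
  have : τ₂.taylorHom.comp (γ.comp (ofLaurent θ)) = ofPS.comp (t.comp τ₁.toPS) := by
    refine ringHom_ext (fun a => ?_) hτ₂
    simp only [RingHom.comp_apply]
    rw [hγ, taylorHom_const, htc]
  exact DFunLike.congr_fun this a

end SkewRes

end

theorem mainTheorem3 {K : Type*} [Field K] (θ : RingAut K) (hθ : IsOfFinOrder θ)
    {Fs : Type*} [Field Fs] [Algebra (SkewRes.FixedField θ) Fs]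
    [IsSepClosure (SkewRes.FixedField θ) Fs]
    (γ : SkewRes.SkewFrac θ →+* SkewRes.SkewFrac θ)
    (hγ : ∀ a : K, γ (SkewRes.ofLaurent θ (SkewRes.SkewLaurent.const θ a)) =
      SkewRes.ofLaurent θ (SkewRes.SkewLaurent.const θ a))
    (z : Fs) (hz : z ≠ 0) (hreg : SkewRes.IsRegularPoint γ z)
    (hpole : SkewRes.HasNoPole z (γ (SkewRes.ofLaurent θ (SkewRes.SkewLaurent.X θ))))
    (hunram : SkewRes.IsUnramifiedPoint γ z) :
    ∃ γbar : SkewRes.Quot θ (minpoly (SkewRes.FixedField θ) (SkewRes.pushPoint γ z)) →+*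
        SkewRes.Quot θ (minpoly (SkewRes.FixedField θ) z),
      SkewRes.IsInducedBy γ z γbar ∧
      (∀ τ₁ : SkewRes.Admissible θ (SkewRes.pushPoint γ z), ∃ τ₂ : SkewRes.Admissible θ z,
        ∀ f : SkewRes.SkewFrac θ, γbar (τ₁.sres f) =
          τ₂.sres (γ f * SkewRes.ofCentral θ (SkewRes.derivY (SkewRes.imageY γ)))) ∧
      (∀ f : SkewRes.SkewFrac θ,
        (SkewRes.HasSimplePole θ (SkewRes.pushPoint γ z) f ↔
          SkewRes.HasSimplePole θ z (γ f)) ∧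
        (SkewRes.HasSimplePole θ (SkewRes.pushPoint γ z) f →
          ∀ (τ₁ : SkewRes.Admissible θ (SkewRes.pushPoint γ z)) (τ₂ : SkewRes.Admissible θ z),
            γbar (τ₁.sres f) =
              τ₂.sres (γ f * SkewRes.ofCentral θ (SkewRes.derivY (SkewRes.imageY γ))))) := by
  obtain ⟨y, U, V, hy, hUV, hexp, hder⟩ := SkewRes.exists_imageY_expansion hreg hunram
  obtain ⟨γbar, hind, hcov⟩ :=
    SkewRes.exists_induced_and_change_of_variables hθ hγ hz hreg hpole hy hexp
  -- A morphism from a simple ring is injective only if its target is nonzero.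
  have := SkewRes.quot_nontrivial (θ := θ) hθ hz
  have hinj : Function.Injective γbar :=
    SkewRes.quot_ringHom_injective hθ (SkewRes.Admissible.irreducible_minpoly _) γbar
  have hsimple : ∀ f, SkewRes.HasSimplePole θ (SkewRes.pushPoint γ z) f ↔ SkewRes.HasSimplePole θ z (γ f) := fun f => by
    obtain ⟨τ₁⟩ := SkewRes.exists_admissible (θ := θ) (z := SkewRes.pushPoint γ z) hθ (div_ne_zero hreg.1 hreg.2)
    obtain ⟨τ₂, t, hτ, hC, hX⟩ := hcov τ₁
    rw [SkewRes.Admissible.hasSimplePole_iff τ₁, SkewRes.Admissible.hasSimplePole_iff τ₂]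
    exact SkewRes.order_taylor_change_of_variables hinj hτ hC hX hUV f
  refine ⟨γbar, hind, fun τ₁ => ?_, fun f => ⟨hsimple f, fun hf τ₁ τ₂ => ?_⟩⟩
  · obtain ⟨τ₂, t, hτ, hC, hX⟩ := hcov τ₁
    exact ⟨τ₂, SkewRes.sres_change_of_variables hτ hC hX hUV (hder τ₂)⟩
  -- For the $\tau_z$ attached to $\tau_1$ the formula is (i). Since $\gamma(f)$ has a simple pole
  -- and the expansion of $d\gamma(Y)/dY$ is integral, the residue on the right is the same for
  -- every $\tau_z$.
  · obtain ⟨τ₂', t, hτ, hC, hX⟩ := hcov τ₁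
    rw [SkewRes.sres_change_of_variables hτ hC hX hUV (hder τ₂') f]
    refine SkewRes.Admissible.sres_eq_sres τ₂' τ₂ ?_
    have h1 := (SkewRes.order_eq_neg_one_iff.1
      ((SkewRes.Admissible.hasSimplePole_iff τ₂').1 ((hsimple f).1 hf))).2
    rw [map_mul, ← mul_assoc]
    refine mul_mem h1 ?_
    rw [SkewRes.Admissible.taylorHom_ofCentral, hder]
    exact ⟨_, rfl⟩
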